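/- Let $0<\varepsilon,\delta<1$ and let $s\ge 1$ be an integer. A random matrix $A\in\mathbb{R}^{m\times d}$ is a ScaledJL$(\varepsilon,\delta,s)$-matrix if for every $x\in\mathbb{R}^d$ $$\Pr_A\big[\,\|s^{-1/2}Ax\|_2\notin[(1-\varepsilon)\|x\|_2,(1+\varepsilon)\|x\|_2]\,\big]<\delta .$$ A linear algorithm takes as input $x_0=1$ and $x_1,\dots,x_d\in\mathbb{R}$ and proceeds in $t>0$ steps (its number of operations). In the $l$-th step it computes $x_{d+l}=\lambda_{d+l}x_j+\mu_{d+l}x_i$ for some indices $0\le i,j<d+l$ and coefficients $\lambda_{d+l},\mu_{d+l}\in\mathbb{R}$. It computes a matrix $B\in\mathbb{R}^{m\times d}$ if there are indices $1\le k_1,\dots,k_m\le d+t$ with $(Bx)_i=x_{k_i}$ for all $i$ and all inputs $x=(x_1,\dots,x_d)\in\mathbb{R}^d$. Let $T(B)$ be the minimum number of operations of a linear algorithm that computes $B$ with all coefficients satisfying $|\lambda_l|,|\mu_l|\le 1$. **Theorem.** There is a universal constant $C>0$ such that for all $a,b>0$ there is a constant $c>0$, depending only on $a$ and $b$, with the following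 property. Let $A\in\mathbb{R}^{m\times d}$ be a ScaledJL$(\varepsilon,\delta,s)$-matrix with $\varepsilon\le 1/4$, $\delta\le C$, $a\,\varepsilon^{-2}\log(1/\delta)\le m\le b\,\varepsilon^{-2}\log(1/\delta)$ and $d\ge m$. Then $$\mathbb{E}_A[T(A)]\ \ge\ c\,m\log s .$$ In particular, if $\log s\ge\kappa\log m$ for some $\kappa>0$, then $\mathbb{E}_A[T(A)]\ge c\,\kappa\, m\log m$. -/

import Mathlib

open MeasureTheory
open scoped ENNReal Matrix

/-- The Borel (product) σ-algebra on real matrices. -/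
instance instMeasurableSpaceRealMatrix {m d : ℕ} : MeasurableSpace (Matrix (Fin m) (Fin d) ℝ) :=
  inferInstanceAs (MeasurableSpace (Fin m → Fin d → ℝ))

/-- The probability distribution `μ` of a random matrix in `ℝ^{m × d}` is that of a
ScaledJL(`ε`, `δ`, `s`)-matrix: for every fixed `x ∈ ℝ^d`, the Euclidean norm of `s^{-1/2} A x` lies
outside `[(1 - ε) ‖x‖, (1 + ε) ‖x‖]` with probability less than `δ`. -/
structure IsScaledJL {m d : ℕ} (μ : Measure (Matrix (Fin m) (Fin d) ℝ)) (ε δ : ℝ) (s : ℕ) :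
    Prop where
  isProbabilityMeasure : IsProbabilityMeasure μ
  eps_pos : 0 < ε
  eps_lt_one : ε < 1
  delta_pos : 0 < δ
  delta_lt_one : δ < 1
  s_pos : 0 < s
  preserves : ∀ x : EuclideanSpace ℝ (Fin d),
    μ {A | ‖(Real.sqrt (s : ℝ))⁻¹ • (WithLp.toLp 2 (A *ᵥ x.ofLp) : EuclideanSpace ℝ (Fin m))‖ ∉
        Set.Icc ((1 - ε) * ‖x‖) ((1 + ε) * ‖x‖)} < ENNReal.ofReal δ

/-- A linear algorithm with `d` input variables and `t` steps. Its registers are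
`x_0, …, x_{d + t}`, where `x_0 = 1` and `x_1, …, x_d` are the inputs; `step P lam mu j i` runs `P`
and then computes one new register `lam * x_j + mu * x_i` from two registers already available. -/
inductive LinearAlgorithm (d : ℕ) : ℕ → Type
  | start : LinearAlgorithm d 0
  | step {t : ℕ} (P : LinearAlgorithm d t) (lam mu : ℝ) (j i : Fin (d + 1 + t)) :
      LinearAlgorithm d (t + 1)

namespace LinearAlgorithm

/-- The contents of all registers `x_0, …, x_{d + t}` at the end of the run on input `x`. -/
def eval {d : ℕ} (x : Fin d → ℝ) : {t : ℕ} → LinearAlgorithm d t → Fin (d + 1 + t) → ℝ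
  | _, start => Fin.cons (α := fun _ => ℝ) 1 x
  | _, step P lam mu j i =>
      Fin.snoc (α := fun _ => ℝ) (eval x P) (lam * eval x P j + mu * eval x P i)

/-- All coefficients used by the algorithm are at most `r` in absolute value. -/
def CoeffBounded {d : ℕ} (r : ℝ) : {t : ℕ} → LinearAlgorithm d t → Prop
  | _, start => True
  | _, step P lam mu _ _ => CoeffBounded r P ∧ |lam| ≤ r ∧ |mu| ≤ r

/-- The algorithm computes `B`: there are registers `x_{k_1}, …, x_{k_m}`, none of them the constant
`x_0 = 1`, that hold the coordinates of `B x` for every input `x`. -/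
def Computes {m d t : ℕ} (P : LinearAlgorithm d t) (B : Matrix (Fin m) (Fin d) ℝ) : Prop :=
  ∃ k : Fin m → Fin (d + 1 + t), (∀ i, 1 ≤ (k i : ℕ)) ∧
    ∀ (x : Fin d → ℝ) (i : Fin m), (B *ᵥ x) i = eval x P (k i)

end LinearAlgorithm

/-- The minimum number `t > 0` of steps of a linear algorithm that computes `B` and whose
coefficients are all at most `1` in absolute value. -/
noncomputable def minOps {m d : ℕ} (B : Matrix (Fin m) (Fin d) ℝ) : ℕ∞ :=
  ⨅ (t : ℕ) (_ : 0 < t ∧ ∃ P : LinearAlgorithm d t, P.CoeffBounded 1 ∧ P.Computes B), (t : ℕ∞)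

/-- The expectation of `minOps A` over a random matrix `A` with distribution `μ`. -/
noncomputable def expectedMinOps {m d : ℕ} (μ : Measure (Matrix (Fin m) (Fin d) ℝ)) : ℝ≥0∞ :=
  ∫⁻ A, (minOps A : ℝ≥0∞) ∂μ

/-! The core is Morgenstern's volume argument. With coefficients bounded by one, a step at most
doubles the largest minor of the register matrix, even after multiplication by a matrix with
orthonormal columns. A matrix with a large Gram determinant is therefore expensive
(`Computes.factorial_mul_det_le`).

The JL property forces such a determinant on a window of `n = ⌈c * m⌉` coordinates. If an eighth of
the eigenvalues of the Gram matrix there were at most `s / 2`, a Gaussian vector in the window would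
be distorted with probability at least `exp (-O(ε² n)) / 4` (`le_gaussianVec_distorted`), which is
at least `16 * δ` for small `c`. Otherwise `k ≥ n / 2` eigenvalues exceed `s / 2` and `k! * (s / 2)
^ k ≤ m ^ k * 4 ^ t`. As `k` is proportional to `m`, this gives `t ≥ k * log s / 4` once `s` exceeds
a constant.

For smaller `s` one needs `t ≥ n / 8` instead. Apart from computed registers, the rows of `A` are
zero or copies of inputs, and since `m ≤ d` at least half of the inputs are copied at most once.
Vectors supported there and killed by the computed registers are not expanded, which creates
eigenvalues at most `1 ≤ s / 2` (`Computes.exists_finset_window`). This set of inputs depends on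
`A`, so all cyclic windows are used at once: by Fubini and Markov, with probability at least `1 / 2`
at most `d / 8` windows are bad, and some other window has a quarter of its coordinates in the set.
-/

/-! ### Cauchy–Binet and minors of matrices with orthonormal columns. -/

/-- The Gram-matrix form of the Cauchy–Binet formula, summed over all row selections. -/
theorem sum_det_submatrix_sq {ι κ : Type*} [Fintype ι] [DecidableEq ι] [Fintype κ] [DecidableEq κ]
    (B : Matrix ι κ ℝ) :
    ∑ f : κ → ι, (B.submatrix f id).det ^ 2 = (Fintype.card κ).factorial * (Bᵀ * B).det := by
  -- Permute the rows of the Gram matrix by `σ` and expand each row, a combination of rows of `B`,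
  -- multilinearly. Summing over `σ` then turns the signed products into a second copy of the
  -- determinant.
  have key : ∀ σ : Equiv.Perm κ, (Bᵀ * B).det =
      ∑ f : κ → ι, (Equiv.Perm.sign σ : ℝ) * (∏ j, B (f j) (σ j)) * (B.submatrix f id).det := by
    intro σ
    have h1 : ((Bᵀ * B).submatrix σ id).det = ∑ f : κ → ι,
        (∏ j, B (f j) (σ j)) * (B.submatrix f id).det := by
      have h2 : ((Bᵀ * B).submatrix σ id) = fun j => ∑ i, B i (σ j) • B i := by
        ext j l
        simp [Matrix.mul_apply]
      have h3 := (Matrix.detRowAlternating (n := κ) (R := ℝ)).toMultilinearMap.map_sum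
        (fun (j : κ) (i : ι) => B i (σ j) • B i)
      rw [h2]
      refine h3.trans (Finset.sum_congr rfl fun f _ => ?_)
      exact (Matrix.detRowAlternating (n := κ) (R := ℝ)).toMultilinearMap.map_smul_univ
        (fun j => B (f j) (σ j)) (fun j => B (f j))
    rw [Matrix.det_permute] at h1
    simp_rw [mul_assoc, ← Finset.mul_sum, ← h1]
    rw [← mul_assoc]
    rcases Int.units_eq_one_or (Equiv.Perm.sign σ) with h | h <;> simp [h]
  have hsum : ∑ σ : Equiv.Perm κ, (Bᵀ * B).det =
      ∑ f : κ → ι, (B.submatrix f id).det ^ 2 := by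
    rw [Finset.sum_congr rfl fun σ _ => key σ, Finset.sum_comm]
    refine Finset.sum_congr rfl fun f _ => ?_
    rw [← Finset.sum_mul, sq]
    congr 1
    rw [← Matrix.det_transpose, Matrix.det_apply']
    rfl
  rw [← hsum]
  simp [Fintype.card_perm]

/-- A selection of rows of a matrix with orthonormal columns has determinant at most one. -/
theorem abs_det_submatrix_le_one {ι κ : Type*} [Fintype ι] [DecidableEq ι] [Fintype κ]
    [DecidableEq κ] {B : Matrix ι κ ℝ} (hB : Bᵀ * B = 1) (f : κ → ι) :
    |(B.submatrix f id).det| ≤ 1 := by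
  by_cases hf : Function.Injective f
  -- The `κ!` reorderings of an injective `f` are distinct selections with equal squared
  -- determinants, inside a sum that equals `κ!`.
  · have h := sum_det_submatrix_sq B
    rw [hB, Matrix.det_one, mul_one] at h
    have h2 : ∑ σ : Equiv.Perm κ, (B.submatrix (f ∘ σ) id).det ^ 2 ≤
        ∑ g : κ → ι, (B.submatrix g id).det ^ 2 := by
      have hinj : Function.Injective fun σ : Equiv.Perm κ => f ∘ σ := by
        intro σ τ h
        ext x
        exact hf (congrFun h x)
      refine (Finset.sum_map Finset.univ ⟨_, hinj⟩
        (fun g => (B.submatrix g id).det ^ 2)).symm.trans_le ?_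
      exact Finset.sum_le_sum_of_subset_of_nonneg (Finset.subset_univ _)
        fun _ _ _ => sq_nonneg _
    have h3 : ∀ σ : Equiv.Perm κ, (B.submatrix (f ∘ σ) id).det ^ 2 =
        (B.submatrix f id).det ^ 2 := by
      intro σ
      have : B.submatrix (f ∘ σ) id = (B.submatrix f id).submatrix σ id := rfl
      rw [this, Matrix.det_permute]
      rcases Int.units_eq_one_or (Equiv.Perm.sign σ) with h | h <;> simp [h]
    simp only [h3, Finset.sum_const, Finset.card_univ, Fintype.card_perm, nsmul_eq_mul, h] at h2
    have hpos : (0 : ℝ) < (Fintype.card κ).factorial := by positivity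
    have h4 : (B.submatrix f id).det ^ 2 ≤ 1 := by
      by_contra hc
      nlinarith
    exact (sq_le_one_iff_abs_le_one _).1 h4
  · simp only [Function.Injective, not_forall] at hf
    obtain ⟨i, j, hij, hne⟩ := hf
    rw [Matrix.det_zero_of_row_eq hne (by ext l; simp [hij])]
    simp

/-! ### Registers as affine forms and the growth of their minors. -/

namespace LinearAlgorithm

/-- The linear parts of the registers of a linear algorithm, as the rows of a matrix. -/
def rows {d : ℕ} : {t : ℕ} → LinearAlgorithm d t → Matrix (Fin (d + 1 + t)) (Fin d) ℝ
  | _, start => Fin.cons (α := fun _ => Fin d → ℝ) 0 (1 : Matrix (Fin d) (Fin d) ℝ)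
  | _, step P lam mu j i =>
      Fin.snoc (α := fun _ => Fin d → ℝ) (rows P) (lam • rows P j + mu • rows P i)

@[simp]
theorem rows_start_zero {d : ℕ} : (start : LinearAlgorithm d 0).rows 0 = 0 := rfl

@[simp]
theorem rows_start_succ {d : ℕ} (j : Fin d) :
    (start : LinearAlgorithm d 0).rows j.succ = (1 : Matrix (Fin d) (Fin d) ℝ) j := rfl

@[simp]
theorem rows_step_castSucc {d t : ℕ} (P : LinearAlgorithm d t) (lam mu : ℝ)
    (j i l : Fin (d + 1 + t)) : (step P lam mu j i).rows l.castSucc = P.rows l :=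
  Fin.snoc_castSucc (α := fun _ => Fin d → ℝ) ..

@[simp]
theorem rows_step_last {d t : ℕ} (P : LinearAlgorithm d t) (lam mu : ℝ)
    (j i : Fin (d + 1 + t)) : (step P lam mu j i).rows (Fin.last (d + 1 + t)) =
      lam • P.rows j + mu • P.rows i :=
  Fin.snoc_last (α := fun _ => Fin d → ℝ) ..

/-- Because `x_0 = 1` is a register, the contents are affine in the input; the constant part is the
run on `0`. -/
theorem eval_eq_eval_zero_add {d t : ℕ} (P : LinearAlgorithm d t) (x : Fin d → ℝ)
    (l : Fin (d + 1 + t)) : P.eval x l = P.eval 0 l + P.rows l ⬝ᵥ x := by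
  induction P with
  | start =>
    refine Fin.cases ?_ (fun j => ?_) l
    · simp [eval]
    · have : (1 : Matrix (Fin d) (Fin d) ℝ) j ⬝ᵥ x = x j := by
        have := congrFun (Matrix.one_mulVec x) j
        simpa [Matrix.mulVec] using this
      erw [rows_start_succ, this]
      simp [eval]
  | step P lam mu j i ih =>
    refine Fin.lastCases ?_ (fun l => ?_) l
    · erw [rows_step_last]
      simp [eval, ih j, ih i]
      ring
    · erw [rows_step_castSucc]
      simpa [eval] using ih l

/-- The zero input shows that output registers have no constant part. -/
theorem Computes.exists_rows_eq {m d t : ℕ} {P : LinearAlgorithm d t}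
    {A : Matrix (Fin m) (Fin d) ℝ} (h : P.Computes A) :
    ∃ k : Fin m → Fin (d + 1 + t), ∀ i, A i = P.rows (k i) := by
  obtain ⟨k, -, hk⟩ := h
  refine ⟨k, fun i => ?_⟩
  have h0 : P.eval 0 (k i) = 0 := by rw [← hk 0 i]; simp
  ext j
  have := hk (Pi.single j 1) i
  rw [eval_eq_eval_zero_add, h0] at this
  simpa using this

theorem rows_of_lt {d t : ℕ} (P : LinearAlgorithm d t) (l : Fin (d + 1 + t))
    (hl : (l : ℕ) < d + 1) :
    P.rows l = 0 ∨ ∃ j, P.rows l = (1 : Matrix (Fin d) (Fin d) ℝ) j := by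
  induction P with
  | start =>
    revert hl
    refine Fin.cases ?_ (fun j => ?_) l
    · intro; left; rfl
    · intro; right; exact ⟨j, rfl⟩
  | @step t' P lam mu j i ih =>
    revert hl
    refine Fin.lastCases ?_ (fun l => ?_) l
    · intro hl
      have : d + 1 + t' < d + 1 := hl
      omega
    · intro hl
      erw [rows_step_castSucc]
      exact ih l hl

/-- With coefficients bounded by one, each step at most doubles the largest subdeterminant. -/
theorem abs_det_rows_mul_submatrix_le {d t : ℕ} {κ : Type*} [Fintype κ] [DecidableEq κ]
    (P : LinearAlgorithm d t) (hP : P.CoeffBounded 1) {U : Matrix (Fin d) κ ℝ} (hU : Uᵀ * U = 1)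
    (f : κ → Fin (d + 1 + t)) : |((P.rows * U).submatrix f id).det| ≤ 2 ^ t := by
  induction P with
  | start =>
    by_cases h0 : ∃ a, f a = 0
    · obtain ⟨a, ha⟩ := h0
      rw [Matrix.det_eq_zero_of_row_eq_zero a]
      · simp
      · intro b
        rw [Matrix.submatrix_apply, ha, Matrix.mul_apply]
        exact Finset.sum_eq_zero fun x _ => zero_mul _
    · push Not at h0
      have hg : ∀ a, ∃ j, f a = Fin.succ j := fun a => Fin.exists_succ_eq.2 (h0 a) |>.imp fun _ h => h.symm
      choose g hg using hg
      have : ((start : LinearAlgorithm d 0).rows * U).submatrix f id = U.submatrix g id := by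
        ext a b
        have h1 := congrFun (congrFun (Matrix.one_mul U) (g a)) b
        rw [Matrix.mul_apply] at h1
        rw [Matrix.submatrix_apply, hg, Matrix.mul_apply]
        exact h1
      rw [this]
      simpa using abs_det_submatrix_le_one hU g
  | @step t P lam mu j i ih =>
    obtain ⟨hP, hlam, hmu⟩ := hP
    have hcast : ∀ l : Fin (d + 1 + t), ((step P lam mu j i).rows * U) l.castSucc
        = (P.rows * U) l := by
      intro l
      ext b
      rw [Matrix.mul_apply, rows_step_castSucc, Matrix.mul_apply]
    have hlast : ((step P lam mu j i).rows * U) (Fin.last (d + 1 + t))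
        = lam • (P.rows * U) j + mu • (P.rows * U) i := by
      ext b
      rw [Matrix.mul_apply, rows_step_last]
      simp [Matrix.mul_apply, Finset.mul_sum, ← Finset.sum_add_distrib]
      refine Finset.sum_congr rfl fun _ _ => ?_
      ring
    have hle : (2 : ℝ) ^ t ≤ 2 ^ (t + 1) := pow_le_pow_right₀ (by norm_num) (by omega)
    by_cases h0 : ∃ a, f a = Fin.last _
    · obtain ⟨a, ha⟩ := h0
      by_cases h1 : ∃ b, b ≠ a ∧ f b = Fin.last _
      · obtain ⟨b, hb, hfb⟩ := h1
        rw [Matrix.det_zero_of_row_eq hb (by ext l; simp [ha, hfb])]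
        simp
      · push Not at h1
        have hg : ∀ b, ∃ l : Fin (d + 1 + t), b ≠ a → f b = l.castSucc := by
          intro b
          by_cases hb : b = a
          -- Row `a` is overwritten below, so any register serves as default.
          · exact ⟨j, fun h => (h hb).elim⟩
          · obtain ⟨l, hl⟩ := Fin.exists_castSucc_eq.2 (h1 b hb)
            exact ⟨l, fun _ => hl.symm⟩
        choose g hg using hg
        have hrow : ∀ l, ((P.rows * U).submatrix g id).updateRow a ((P.rows * U) l) =
            (P.rows * U).submatrix (Function.update g a l) id := by
          intro l
          ext b c
          by_cases hb : b = a
          · subst hb; simp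
          · simp [hb]
        have : ((step P lam mu j i).rows * U).submatrix f id =
            ((P.rows * U).submatrix g id).updateRow a
              (lam • (P.rows * U) j + mu • (P.rows * U) i) := by
          ext b c
          by_cases hb : b = a
          · subst hb
            rw [Matrix.submatrix_apply, ha]
            erw [hlast]
            simp
          · rw [Matrix.submatrix_apply, hg b hb, hcast]
            simp [hb]
        rw [this, Matrix.det_updateRow_add, Matrix.det_updateRow_smul, Matrix.det_updateRow_smul,
          hrow, hrow]
        have e1 := ih hP (Function.update g a j)
        have e2 := ih hP (Function.update g a i)
        calc _ ≤ |lam| * _ + |mu| * _ := by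
              rw [← abs_mul, ← abs_mul]; exact abs_add_le _ _
          _ ≤ 1 * 2 ^ t + 1 * 2 ^ t := by gcongr
          _ = 2 ^ (t + 1) := by ring
    · push Not at h0
      have hg : ∀ a, ∃ l : Fin (d + 1 + t), f a = l.castSucc := fun a =>
        Fin.exists_castSucc_eq.2 (h0 a) |>.imp fun _ h => h.symm
      choose g hg using hg
      have : ((step P lam mu j i).rows * U).submatrix f id = (P.rows * U).submatrix g id := by
        ext a b
        rw [Matrix.submatrix_apply, hg, hcast]
        simp
      rw [this]
      exact (ih hP g).trans hle

/-- By Cauchy–Binet the left side is a sum of `m ^ card κ` squared minors, each also a squared minor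
of the register matrix times `U`. -/
theorem Computes.factorial_mul_det_le {m d t : ℕ} {κ : Type*} [Fintype κ] [DecidableEq κ]
    {P : LinearAlgorithm d t} {A : Matrix (Fin m) (Fin d) ℝ} (h : P.Computes A)
    (hP : P.CoeffBounded 1) {U : Matrix (Fin d) κ ℝ} (hU : Uᵀ * U = 1) :
    (Fintype.card κ).factorial * ((A * U)ᵀ * (A * U)).det ≤
      (m : ℝ) ^ Fintype.card κ * 4 ^ t := by
  obtain ⟨k, hk⟩ := h.exists_rows_eq
  rw [← sum_det_submatrix_sq]
  calc _ ≤ ∑ f : κ → Fin m, (4 : ℝ) ^ t := by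
        refine Finset.sum_le_sum fun f _ => ?_
        have h1 : (A * U).submatrix f id = (P.rows * U).submatrix (k ∘ f) id := by
          ext a b
          simp [Matrix.mul_apply, hk]
        have h2 := P.abs_det_rows_mul_submatrix_le hP hU (k ∘ f)
        rw [h1, ← sq_abs]
        calc _ ≤ ((2 : ℝ) ^ t) ^ 2 := by gcongr
          _ = 4 ^ t := by rw [← pow_mul, mul_comm, pow_mul]; norm_num
    _ = _ := by simp

end LinearAlgorithm

/-! ### Gaussian vectors: tails, rescaling and anti-concentration. -/

section Gaussian
variable {ι E : Type*} [Fintype ι] [NormedAddCommGroup E] [InnerProductSpace ℝ E]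

/-- The diagonal map scaling the `i`-th axis of an orthonormal basis by `c i`. -/
noncomputable def scaleAxes (b : OrthonormalBasis ι ℝ E) (c : ι → ℝ) : E →ₗ[ℝ] E :=
  b.toBasis.constr ℝ fun i => c i • b i

theorem inner_scaleAxes (b : OrthonormalBasis ι ℝ E) (c : ι → ℝ) (x : E) (i : ι) :
    inner ℝ (b i) (scaleAxes b c x) = c i * inner ℝ (b i) x := by
  classical
  rw [scaleAxes, Module.Basis.constr_apply_fintype, inner_sum]
  simp [inner_smul_right, b.inner_eq_ite, b.repr_apply_apply, mul_comm]

theorem det_scaleAxes (b : OrthonormalBasis ι ℝ E) (c : ι → ℝ) :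
    LinearMap.det (scaleAxes b c) = ∏ i, c i := by
  classical
  rw [← LinearMap.det_toMatrix b.toBasis, ← Matrix.det_diagonal]
  congr 1
  ext i j
  by_cases h : i = j <;> simp [LinearMap.toMatrix_apply, scaleAxes, h]

theorem OrthonormalBasis.norm_sq_eq_sum (b : OrthonormalBasis ι ℝ E) (x : E) :
    ‖x‖ ^ 2 = ∑ i, inner ℝ (b i) x ^ 2 := by
  simp [← b.sum_sq_norm_inner_right]

variable [FiniteDimensional ℝ E] [MeasurableSpace E] [BorelSpace E]

theorem lintegral_exp_neg_half_norm_sq :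
    ∫⁻ x : E, ENNReal.ofReal (Real.exp (-(1 / 2) * ‖x‖ ^ 2)) ≠ 0 ∧
    ∫⁻ x : E, ENNReal.ofReal (Real.exp (-(1 / 2) * ‖x‖ ^ 2)) ≠ ∞ := by
  have h := GaussianFourier.integral_rexp_neg_mul_sq_norm (V := E) (b := 1 / 2) (by norm_num)
  have hpos : 0 < ∫ v : E, Real.exp (-(1 / 2) * ‖v‖ ^ 2) := by
    rw [h]; positivity
  have hint : Integrable fun v : E => Real.exp (-(1 / 2) * ‖v‖ ^ 2) := by
    by_contra hc
    rw [integral_undef hc] at hpos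
    exact lt_irrefl _ hpos
  rw [← ofReal_integral_eq_lintegral_ofReal hint (ae_of_all _ fun _ => (Real.exp_pos _).le)]
  exact ⟨by simpa using hpos, ENNReal.ofReal_ne_top⟩

/-- The standard Gaussian measure of a finite-dimensional inner product space, by its density. -/
noncomputable def gaussianVec (E : Type*) [NormedAddCommGroup E] [InnerProductSpace ℝ E]
    [FiniteDimensional ℝ E] [MeasurableSpace E] [BorelSpace E] : Measure E :=
  (∫⁻ x : E, ENNReal.ofReal (Real.exp (-(1 / 2) * ‖x‖ ^ 2)))⁻¹ •
    volume.withDensity fun x : E => ENNReal.ofReal (Real.exp (-(1 / 2) * ‖x‖ ^ 2))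

theorem lintegral_gaussianVec {f : E → ℝ≥0∞} (hf : Measurable f) :
    ∫⁻ x, f x ∂gaussianVec E =
      (∫⁻ x : E, ENNReal.ofReal (Real.exp (-(1 / 2) * ‖x‖ ^ 2)))⁻¹ *
        ∫⁻ x, ENNReal.ofReal (Real.exp (-(1 / 2) * ‖x‖ ^ 2)) * f x := by
  rw [gaussianVec, lintegral_smul_measure, lintegral_withDensity_eq_lintegral_mul _ (by fun_prop) hf]
  rfl

instance : IsProbabilityMeasure (gaussianVec E) := by
  refine ⟨?_⟩
  rw [← lintegral_one, lintegral_gaussianVec measurable_const]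
  simp only [mul_one]
  exact ENNReal.inv_mul_cancel lintegral_exp_neg_half_norm_sq.1 lintegral_exp_neg_half_norm_sq.2

/-- Change of variables: the rescaled Gaussian has variance `1 / w i` along `b i`, and the prefactor
times the exponential is its density relative to the standard one. -/
theorem lintegral_gaussianVec_comp_scaleAxes (b : OrthonormalBasis ι ℝ E) {w : ι → ℝ}
    (hw : ∀ i, 0 < w i) {f : E → ℝ≥0∞} (hf : Measurable f) :
    ∫⁻ x, f (scaleAxes b (fun i => (√(w i))⁻¹) x) ∂gaussianVec E =
      ENNReal.ofReal (∏ i, √(w i)) * ∫⁻ y, ENNReal.ofReal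
        (Real.exp (-(1 / 2) * ∑ i, (w i - 1) * inner ℝ (b i) y ^ 2)) * f y ∂gaussianVec E := by
  set φ := scaleAxes b (fun i => (√(w i))⁻¹) with hφ
  have hdet : LinearMap.det φ = (∏ i, √(w i))⁻¹ := by
    rw [hφ, det_scaleAxes, Finset.prod_inv_distrib]
  have hpos : 0 < ∏ i, √(w i) := Finset.prod_pos fun i _ => Real.sqrt_pos.2 (hw i)
  have hφm : Measurable φ := (LinearMap.continuous_of_finiteDimensional φ).measurable
  have hnorm : ∀ x, ‖x‖ ^ 2 = ∑ i, w i * inner ℝ (b i) (φ x) ^ 2 := by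
    intro x
    rw [← b.sum_sq_norm_inner_right]
    refine Finset.sum_congr rfl fun i _ => ?_
    rw [hφ, inner_scaleAxes, mul_pow, inv_pow, Real.sq_sqrt (hw i).le, ← mul_assoc,
      mul_inv_cancel₀ (hw i).ne', one_mul]
    simp
  have hmap := Measure.map_linearMap_addHaar_eq_smul_addHaar (volume : Measure E) (f := φ)
    (by rw [hdet]; exact (inv_pos.2 hpos).ne')
  set F : E → ℝ≥0∞ := fun y =>
    ENNReal.ofReal (Real.exp (-(1 / 2) * ∑ i, w i * inner ℝ (b i) y ^ 2)) * f y with hF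
  have hFm : Measurable F := by
    refine Measurable.mul ?_ hf
    fun_prop
  rw [lintegral_gaussianVec (f := fun x => f (φ x)) (hf.comp hφm),
    lintegral_gaussianVec (by fun_prop)]
  have h1 : ∫⁻ x, ENNReal.ofReal (Real.exp (-(1 / 2) * ‖x‖ ^ 2)) * f (φ x) = ∫⁻ x, F (φ x) := by
    refine lintegral_congr fun x => ?_
    rw [hF, hnorm]
  rw [h1, ← lintegral_map hFm hφm, hmap, lintegral_smul_measure, hdet, inv_inv,
    abs_of_pos hpos, smul_eq_mul, mul_left_comm]
  congr 2
  refine lintegral_congr fun y => ?_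
  rw [hF, ← mul_assoc, ← ENNReal.ofReal_mul (Real.exp_pos _).le, ← Real.exp_add]
  have h2 : -(1 / 2) * ‖y‖ ^ 2 + -(1 / 2) * ∑ i, (w i - 1) * inner ℝ (b i) y ^ 2 =
      -(1 / 2) * ∑ i, w i * inner ℝ (b i) y ^ 2 := by
    simp_rw [b.norm_sq_eq_sum, Finset.mul_sum, ← Finset.sum_add_distrib]
    refine Finset.sum_congr rfl fun i _ => ?_
    ring
  rw [h2]

theorem lintegral_gaussianVec_exp (b : OrthonormalBasis ι ℝ E) {w : ι → ℝ}
    (hw : ∀ i, 0 < w i) :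
    ∫⁻ y, ENNReal.ofReal (Real.exp (-(1 / 2) * ∑ i, (w i - 1) * inner ℝ (b i) y ^ 2))
      ∂gaussianVec E = ENNReal.ofReal (∏ i, √(w i))⁻¹ := by
  have h := lintegral_gaussianVec_comp_scaleAxes b hw (f := fun _ => 1) measurable_const
  have hpos : 0 < ∏ i, √(w i) := Finset.prod_pos fun i _ => Real.sqrt_pos.2 (hw i)
  simp only [lintegral_const, measure_univ, mul_one] at h
  rw [ENNReal.ofReal_inv_of_pos hpos]
  exact ENNReal.eq_inv_of_mul_eq_one_left ((mul_comm _ _).trans h.symm)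

/-- Chernoff's method with a diagonal quadratic form. Weights below one serve upper tails, weights
above one lower tails. -/
theorem gaussianVec_le_of_forall_le (b : OrthonormalBasis ι ℝ E) {w : ι → ℝ}
    (hw : ∀ i, 0 < w i) {A : Set E} {c : ℝ}
    (hA : ∀ y ∈ A, c ≤ -(1 / 2) * ∑ i, (w i - 1) * inner ℝ (b i) y ^ 2) :
    gaussianVec E A ≤ ENNReal.ofReal (Real.exp (-c) * (∏ i, √(w i))⁻¹) := by
  have h := mul_meas_ge_le_lintegral (μ := gaussianVec E) (f := fun y => ENNReal.ofReal
    (Real.exp (-(1 / 2) * ∑ i, (w i - 1) * inner ℝ (b i) y ^ 2))) (by fun_prop)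
    (ENNReal.ofReal (Real.exp c))
  rw [lintegral_gaussianVec_exp b hw] at h
  have h2 : gaussianVec E A ≤ gaussianVec E {y | ENNReal.ofReal (Real.exp c) ≤ ENNReal.ofReal
      (Real.exp (-(1 / 2) * ∑ i, (w i - 1) * inner ℝ (b i) y ^ 2))} :=
    measure_mono fun y hy => ENNReal.ofReal_le_ofReal (Real.exp_le_exp.2 (hA y hy))
  calc gaussianVec E A = ENNReal.ofReal (Real.exp (-c)) * (ENNReal.ofReal (Real.exp c) *
        gaussianVec E A) := by
        rw [← mul_assoc, ← ENNReal.ofReal_mul (Real.exp_pos _).le, ← Real.exp_add]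
        simp
    _ ≤ ENNReal.ofReal (Real.exp (-c)) * ENNReal.ofReal (∏ i, √(w i))⁻¹ := by
        gcongr
        exact (mul_le_mul_right h2 _).trans h
    _ = _ := (ENNReal.ofReal_mul (Real.exp_pos _).le).symm

theorem gaussianVec_norm_sq_gt_le [Nonempty ι] (b : OrthonormalBasis ι ℝ E) :
    gaussianVec E {x | 12 * (Fintype.card ι : ℝ) < ‖x‖ ^ 2} ≤ ENNReal.ofReal (1 / 10) := by
  refine (gaussianVec_le_of_forall_le b (w := fun _ => 1 / 2) (fun _ => by norm_num)
    (c := 3 * Fintype.card ι) ?_).trans (ENNReal.ofReal_le_ofReal ?_)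
  · intro y hy
    have hy' : 12 * (Fintype.card ι : ℝ) < ‖y‖ ^ 2 := hy
    rw [← Finset.mul_sum, ← b.norm_sq_eq_sum]
    linarith
  · have h1 : Real.exp (-(3 * Fintype.card ι)) * (∏ i : ι, √(1 / 2 : ℝ))⁻¹ =
        (Real.exp (-3) * (√(1 / 2))⁻¹) ^ Fintype.card ι := by
      rw [mul_pow, ← Real.exp_nat_mul]
      simp [mul_comm]
    have h2 : Real.exp (-3) * (√(1 / 2))⁻¹ ≤ 1 / 10 := by
      rw [Real.exp_neg, ← mul_inv, one_div (10 : ℝ)]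
      refine inv_anti₀ (by norm_num) ?_
      have e1 : (2.7 : ℝ) ^ 3 ≤ Real.exp 3 := by
        have := Real.exp_one_gt_d9
        rw [show (3 : ℝ) = (3 : ℕ) * 1 by norm_num, Real.exp_nat_mul]
        gcongr
        linarith
      have e2 : (0.7 : ℝ) ≤ √(1 / 2) := Real.le_sqrt_of_sq_le (by norm_num)
      calc (10 : ℝ) ≤ 2.7 ^ 3 * 0.7 := by norm_num
        _ ≤ _ := by gcongr
    rw [h1]
    calc _ ≤ (1 / 10 : ℝ) ^ Fintype.card ι := by gcongr
      _ ≤ 1 / 10 := pow_le_of_le_one (by norm_num) (by norm_num) Fintype.card_ne_zero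

theorem gaussianVec_sum_sq_lt_le (b : OrthonormalBasis ι ℝ E) {S : Finset ι} (hS : S.Nonempty) :
    gaussianVec E {x | 400 * ∑ i ∈ S, inner ℝ (b i) x ^ 2 < S.card} ≤
      ENNReal.ofReal (1 / 10) := by
  classical
  refine (gaussianVec_le_of_forall_le b (w := fun i => if i ∈ S then 401 else 1)
    (fun _ => by split_ifs <;> norm_num) (c := -(S.card / 2)) ?_).trans
    (ENNReal.ofReal_le_ofReal ?_)
  · intro y hy
    have hy' : 400 * ∑ i ∈ S, inner ℝ (b i) y ^ 2 < S.card := hy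
    have : ∑ i, ((if i ∈ S then 401 else 1 : ℝ) - 1) * inner ℝ (b i) y ^ 2 =
        400 * ∑ i ∈ S, inner ℝ (b i) y ^ 2 := by
      rw [Finset.mul_sum, ← Finset.sum_subset (Finset.subset_univ S)]
      · refine Finset.sum_congr rfl fun i hi => ?_
        simp only [hi, if_true]
        norm_num
      · intro i _ hi
        simp [hi]
    rw [this]
    linarith
  · have h1 : Real.exp (-(-(S.card / 2))) * (∏ i : ι, √(if i ∈ S then 401 else 1 : ℝ))⁻¹ =
        (Real.exp (1 / 2) * (√401)⁻¹) ^ S.card := by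
      have : ∏ i : ι, √(if i ∈ S then 401 else 1 : ℝ) = √401 ^ S.card := by
        rw [← Finset.prod_subset (Finset.subset_univ S), ← Finset.prod_const]
        · exact Finset.prod_congr rfl fun i hi => by simp [hi]
        · intro i _ hi
          simp [hi]
      rw [this, mul_pow, ← Real.exp_nat_mul, inv_pow]
      congr 2
      ring
    have h2 : Real.exp (1 / 2) * (√401)⁻¹ ≤ 1 / 10 := by
      rw [← div_eq_mul_inv, div_le_iff₀ (by positivity)]
      have e1 : Real.exp (1 / 2) ≤ 2 := by
        have h := Real.exp_one_lt_d9
        have : Real.exp (1 / 2) ^ 2 = Real.exp 1 := by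
          rw [← Real.exp_nat_mul]; norm_num
        nlinarith [Real.exp_pos (1 / 2)]
      have e2 : (20 : ℝ) ≤ √401 := Real.le_sqrt_of_sq_le (by norm_num)
      linarith
    rw [h1]
    calc _ ≤ (1 / 10 : ℝ) ^ S.card := by gcongr
      _ ≤ 1 / 10 := pow_le_of_le_one (by norm_num) (by norm_num) hS.card_pos.ne'

/-- Rescaling a Gaussian vector along some axes increases the probability of an event at most by
an explicit factor, up to an additive constant. -/
theorem gaussianVec_preimage_scaleAxes_le [DecidableEq ι] (b : OrthonormalBasis ι ℝ E)
    (T : Finset ι) {η : ℝ} (hη : 0 ≤ η) {B : Set E} (hB : MeasurableSet B) :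
    gaussianVec E (scaleAxes b (fun i => (√(if i ∈ T then 1 + η else 1))⁻¹) ⁻¹' B) ≤
      ENNReal.ofReal (1 / 4) + ENNReal.ofReal (Real.exp (η ^ 2 / 2 * Fintype.card ι)) *
        gaussianVec E B := by
  set w : ι → ℝ := fun i => if i ∈ T then 1 + η else 1 with hw
  set R := Real.exp (η ^ 2 / 2 * Fintype.card ι) with hR
  have hRpos : 0 < R := Real.exp_pos _
  have hw1 : ∀ i, 1 ≤ w i := fun i => by
    simp only [hw]; split_ifs <;> linarith
  have hw0 : ∀ i, 0 < w i := fun i => zero_lt_one.trans_le (hw1 i)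
  have hw2 : ∀ i, 0 < 2 * w i - 1 := fun i => by linarith [hw1 i]
  have hWpos : 0 < ∏ i, √(w i) := Finset.prod_pos fun i _ => Real.sqrt_pos.2 (hw0 i)
  set ρ : E → ℝ := fun y =>
    (∏ i, √(w i)) * Real.exp (-(1 / 2) * ∑ i, (w i - 1) * inner ℝ (b i) y ^ 2) with hρ
  have hρpos : ∀ y, 0 < ρ y := fun y => mul_pos hWpos (Real.exp_pos _)
  have hφm : Measurable (scaleAxes b fun i => (√(w i))⁻¹) :=
    (LinearMap.continuous_of_finiteDimensional _).measurable
  have hρm : Measurable ρ := by fun_prop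
  -- A rescaled axis contributes `w / √(2 * w - 1)` with `w = 1 + η`. Since `(1 + η) ^ 2 ≤ (1 + η ^
  -- 2) * (1 + 2 * η)`, the cost per axis is only of second order in `η`.
  have hsq : ∫⁻ y, ENNReal.ofReal (ρ y ^ 2) ∂gaussianVec E ≤ ENNReal.ofReal R := by
    have h1 : ∀ y, ENNReal.ofReal (ρ y ^ 2) = ENNReal.ofReal (∏ i, w i) * ENNReal.ofReal
        (Real.exp (-(1 / 2) * ∑ i, ((2 * w i - 1) - 1) * inner ℝ (b i) y ^ 2)) := by
      intro y
      rw [← ENNReal.ofReal_mul (Finset.prod_nonneg fun i _ => (hw0 i).le)]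
      congr 1
      simp only [hρ]
      rw [mul_pow, ← Finset.prod_pow, ← Real.exp_nat_mul]
      congr 1
      · exact Finset.prod_congr rfl fun i _ => Real.sq_sqrt (hw0 i).le
      · congr 1
        simp only [Finset.mul_sum]
        refine Finset.sum_congr rfl fun i _ => ?_
        push_cast
        ring
    simp_rw [h1]
    rw [lintegral_const_mul _ (by fun_prop), lintegral_gaussianVec_exp b hw2,
      ← ENNReal.ofReal_mul (Finset.prod_nonneg fun i _ => (hw0 i).le)]
    refine ENNReal.ofReal_le_ofReal ?_
    rw [← Finset.prod_inv_distrib, ← Finset.prod_mul_distrib]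
    calc _ ≤ ∏ _i : ι, Real.exp (η ^ 2 / 2) := by
          refine Finset.prod_le_prod (fun i _ => mul_nonneg (hw0 i).le (by positivity)) ?_
          intro i _
          rw [← div_eq_mul_inv, div_le_iff₀ (Real.sqrt_pos.2 (hw2 i))]
          refine le_of_sq_le_sq ?_ (by positivity)
          rw [mul_pow, Real.sq_sqrt (hw2 i).le, ← Real.exp_nat_mul]
          have e1 : 1 + η ^ 2 ≤ Real.exp ((2 : ℕ) * (η ^ 2 / 2)) := by
            have := Real.add_one_le_exp ((2 : ℕ) * (η ^ 2 / 2))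
            push_cast at this ⊢
            linarith
          refine le_trans ?_ (mul_le_mul_of_nonneg_right e1 (hw2 i).le)
          simp only [hw]
          split_ifs
          · nlinarith [pow_nonneg hη 3]
          · nlinarith
      _ = R := by
          rw [Finset.prod_const, ← Real.exp_nat_mul, hR, Finset.card_univ]
          congr 1
          ring
  calc gaussianVec E (scaleAxes b (fun i => (√(w i))⁻¹) ⁻¹' B)
      = ∫⁻ x, B.indicator 1 (scaleAxes b (fun i => (√(w i))⁻¹) x) ∂gaussianVec E := by
        rw [← lintegral_indicator_one (hφm hB)]
        rfl
    _ = ∫⁻ y, ENNReal.ofReal (ρ y) * B.indicator 1 y ∂gaussianVec E := by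
        rw [lintegral_gaussianVec_comp_scaleAxes b hw0 (measurable_one.indicator hB),
          ← lintegral_const_mul _ (by
            refine Measurable.mul (by fun_prop) (measurable_one.indicator hB))]
        refine lintegral_congr fun y => ?_
        rw [← mul_assoc, ← ENNReal.ofReal_mul hWpos.le]
    -- AM–GM on `B`: `ρ ≤ ρ ^ 2 / (4 * R) + R`. By `hsq` the first term integrates to at most `1 /
    -- 4`.
    _ ≤ ∫⁻ y, (ENNReal.ofReal (1 / (4 * R)) * ENNReal.ofReal (ρ y ^ 2) +
          ENNReal.ofReal R * B.indicator 1 y) ∂gaussianVec E := by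
        refine lintegral_mono fun y => ?_
        by_cases hy : y ∈ B
        · simp only [hy, Set.indicator_of_mem, Pi.one_apply, mul_one]
          rw [← ENNReal.ofReal_mul (by positivity), ← ENNReal.ofReal_add (by positivity) hRpos.le]
          refine ENNReal.ofReal_le_ofReal ?_
          have : 1 / (4 * R) * ρ y ^ 2 + R - ρ y = (ρ y - 2 * R) ^ 2 / (4 * R) := by
            field_simp
            ring
          have h2 : 0 ≤ (ρ y - 2 * R) ^ 2 / (4 * R) := by positivity
          linarith
        · simp [hy]
    _ ≤ _ := by
        rw [lintegral_add_left (by fun_prop), lintegral_const_mul _ (by fun_prop),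
          lintegral_const_mul _ (measurable_one.indicator hB), lintegral_indicator_one hB]
        gcongr
        refine (mul_le_mul_right hsq _).trans ?_
        rw [← ENNReal.ofReal_mul (by positivity)]
        refine ENNReal.ofReal_le_ofReal (le_of_eq ?_)
        field_simp

/-- Here `a` and `r` stand for the quadratic form and squared norm on the axes with small
eigenvalues, `c` and `D` for those on the other axes, which get rescaled. Subtracting the two
distortion bounds leaves `η * r / 16 ≤ 4 * ε * (r + D)`, and `2457600 = 3200 * 64 * 12`. -/
theorem gap_of_rescaled_distortion {ε η a c r D n : ℝ} (hε : 0 < ε) (hε' : ε ≤ 1 / 4) (hη : 0 < η)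
    (h1 : a + c ≤ (1 + ε) ^ 2 * (r + D))
    (h2 : (1 - ε) ^ 2 * (r + (1 + η)⁻¹ * D) ≤ a + (1 + η)⁻¹ * c) (ha : a ≤ 1 / 2 * r)
    (hr : n ≤ 3200 * r) (hD : r + D ≤ 12 * n) (hn : 0 < n) : η ≤ 2457600 * ε := by
  have h3 : (1 - ε) ^ 2 * ((1 + η) * r + D) ≤ (1 + η) * a + c := by
    have h := mul_le_mul_of_nonneg_left h2 (by linarith : (0 : ℝ) ≤ 1 + η)
    have e1 : (1 + η) * ((1 - ε) ^ 2 * (r + (1 + η)⁻¹ * D)) =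
        (1 - ε) ^ 2 * ((1 + η) * r + D) := by field_simp
    have e2 : (1 + η) * (a + (1 + η)⁻¹ * c) = (1 + η) * a + c := by field_simp
    rwa [e1, e2] at h
  have h4 : η * a ≤ η * (1 / 2 * r) := mul_le_mul_of_nonneg_left ha hη.le
  have hr0 : 0 < r := by linarith
  have h5 : 9 / 16 ≤ (1 - ε) ^ 2 := by nlinarith
  have h6 : 9 / 16 * (η * r) ≤ (1 - ε) ^ 2 * (η * r) := by gcongr
  have h7 : η * r ≤ 64 * ε * (r + D) := by nlinarith
  have h8 : η * n ≤ 2457600 * ε * n := by nlinarith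
  exact le_of_mul_le_mul_right h8 hn

/-- A diagonal quadratic form with a constant fraction of eigenvalues at most `1 / 2` does not
approximate the squared norm of a Gaussian vector, with an explicit probability. -/
theorem le_gaussianVec_distorted [Nonempty ι] (b : OrthonormalBasis ι ℝ E) {lam : ι → ℝ}
    (hcard : Fintype.card ι ≤ 8 * (Finset.univ.filter fun i => lam i ≤ 1 / 2).card)
    {ε : ℝ} (hε : 0 < ε) (hε' : ε ≤ 1 / 4) :
    ENNReal.ofReal (Real.exp (-((3000000 * ε) ^ 2 / 2 * Fintype.card ι)) / 4) ≤
      gaussianVec E {x | ∑ i, lam i * inner ℝ (b i) x ^ 2 ∉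
        Set.Icc ((1 - ε) ^ 2 * ‖x‖ ^ 2) ((1 + ε) ^ 2 * ‖x‖ ^ 2)} := by
  classical
  set S := Finset.univ.filter fun i => lam i ≤ 1 / 2 with hS
  -- Any multiple of `ε` above `2457600` contradicts `gap_of_rescaled_distortion`.
  set η := 3000000 * ε with hη
  have hηpos : 0 < η := by positivity
  set B := {x | ∑ i, lam i * inner ℝ (b i) x ^ 2 ∉
        Set.Icc ((1 - ε) ^ 2 * ‖x‖ ^ 2) ((1 + ε) ^ 2 * ‖x‖ ^ 2)} with hB
  have hcpos : 0 < Fintype.card ι := Fintype.card_pos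
  have hSne : S.Nonempty := Finset.card_pos.1 (by omega)
  have hBm : MeasurableSet B := by
    have e : B = ({x : E | (1 - ε) ^ 2 * ‖x‖ ^ 2 ≤ ∑ i, lam i * inner ℝ (b i) x ^ 2} ∩
        {x : E | ∑ i, lam i * inner ℝ (b i) x ^ 2 ≤ (1 + ε) ^ 2 * ‖x‖ ^ 2})ᶜ := by
      ext x; simp [hB, Set.mem_Icc]
    rw [e]
    exact ((measurableSet_le (by fun_prop) (by fun_prop)).inter
      (measurableSet_le (by fun_prop) (by fun_prop))).compl
  set φ := scaleAxes b (fun i => (√(if i ∈ Sᶜ then 1 + η else 1))⁻¹) with hφ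
  -- If neither `x` nor its rescaling is distorted, then `x` is atypical: its norm is large or its
  -- part along `S` is small.
  have hcover : (Set.univ : Set E) ⊆ (B ∪ φ ⁻¹' B) ∪
      ({x | 12 * (Fintype.card ι : ℝ) < ‖x‖ ^ 2} ∪
        {x | 400 * ∑ i ∈ S, inner ℝ (b i) x ^ 2 < S.card}) := by
    intro x _
    by_contra hx
    simp only [Set.mem_union, not_or, Set.mem_ofPred_eq, not_lt, Set.mem_preimage] at hx
    obtain ⟨⟨hx1, hx2⟩, hx3, hx4⟩ := hx
    simp only [hB, Set.mem_ofPred_eq, not_not, Set.mem_Icc] at hx1 hx2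
    have hsplit : ∀ F : ι → ℝ, ∑ i, F i = ∑ i ∈ S, F i + ∑ i ∈ Sᶜ, F i := fun F =>
      (Finset.sum_add_sum_compl S F).symm
    have hin : ∀ i, inner ℝ (b i) (φ x) ^ 2 =
        (if i ∈ S then 1 else (1 + η)⁻¹) * inner ℝ (b i) x ^ 2 := by
      intro i
      rw [hφ, inner_scaleAxes, mul_pow, inv_pow]
      by_cases hi : i ∈ S
      · simp [hi]
      · simp [hi, Real.sq_sqrt (by positivity : 0 ≤ 1 + η)]
    have hin2 : ∀ c : ι → ℝ, ∑ i, c i * inner ℝ (b i) (φ x) ^ 2 =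
        ∑ i ∈ S, c i * inner ℝ (b i) x ^ 2 +
          (1 + η)⁻¹ * ∑ i ∈ Sᶜ, c i * inner ℝ (b i) x ^ 2 := by
      intro c
      rw [hsplit, Finset.mul_sum]
      congr 1
      · exact Finset.sum_congr rfl fun i hi => by rw [hin]; simp [hi]
      · refine Finset.sum_congr rfl fun i hi => ?_
        rw [hin, if_neg (Finset.mem_compl.1 hi)]
        ring
    have hin3 := hin2 fun _ => 1
    simp only [one_mul] at hin3
    have h1 := hx1.2
    have h2 := hx2.1
    rw [b.norm_sq_eq_sum, hsplit] at h1
    rw [hsplit (fun i => inner ℝ (b i) x ^ 2)] at h1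
    rw [b.norm_sq_eq_sum, hin2, hin3] at h2
    rw [b.norm_sq_eq_sum, hsplit] at hx3
    have hcast : (Fintype.card ι : ℝ) ≤ 8 * S.card := by exact_mod_cast hcard
    have := gap_of_rescaled_distortion hε hε' hηpos h1 h2 (by
      rw [Finset.mul_sum]
      refine Finset.sum_le_sum fun i hi => ?_
      have : lam i ≤ 1 / 2 := (Finset.mem_filter.1 hi).2
      gcongr) (n := Fintype.card ι) (by linarith) hx3 (by exact_mod_cast hcpos)
    rw [hη] at this
    linarith
  have hsum : 1 ≤ (gaussianVec E B + gaussianVec E (φ ⁻¹' B)) +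
      (ENNReal.ofReal (1 / 10) + ENNReal.ofReal (1 / 10)) := by
    rw [← measure_univ (μ := gaussianVec E)]
    refine (measure_mono hcover).trans ((measure_union_le _ _).trans ?_)
    refine add_le_add (measure_union_le _ _) ((measure_union_le _ _).trans ?_)
    exact add_le_add (gaussianVec_norm_sq_gt_le b) (gaussianVec_sum_sq_lt_le b hSne)
  have hpre := gaussianVec_preimage_scaleAxes_le b Sᶜ hηpos.le hBm
  set R := Real.exp (η ^ 2 / 2 * Fintype.card ι) with hR
  have hR1 : 1 ≤ R := Real.one_le_exp (by positivity)
  rw [Real.exp_neg, ← hR]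
  have hfin : gaussianVec E B = ENNReal.ofReal ((gaussianVec E B).toReal) :=
    (ENNReal.ofReal_toReal (measure_ne_top _ _)).symm
  set β := (gaussianVec E B).toReal with hβ
  have hβ0 : 0 ≤ β := ENNReal.toReal_nonneg
  rw [hfin]
  have hall := hsum.trans (add_le_add_left (add_le_add_right hpre _) _)
  rw [hfin, ← ENNReal.ofReal_mul (by positivity), ← ENNReal.ofReal_add (by positivity)
    (by positivity), ← ENNReal.ofReal_add (by positivity) (by positivity),
    ← ENNReal.ofReal_add (by positivity) (by positivity),
    ← ENNReal.ofReal_add (by positivity) (by positivity), ENNReal.one_le_ofReal] at hall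
  refine ENNReal.ofReal_le_ofReal ?_
  -- What remains is `1 - 1 / 4 - 1 / 5 = 11 / 20 ≤ β + R * β ≤ 2 * R * β`.
  have h9 : 1 ≤ 4 * (R * β) := by nlinarith
  rw [div_le_iff₀ (by norm_num), inv_le_iff_one_le_mul₀ (by positivity)]
  linarith

end Gaussian

/-! ### Spectral decomposition of the Gram matrix. -/

section Spectral
variable {p n : ℕ}

theorem norm_sq_toLp_mulVec (N : Matrix (Fin p) (Fin n) ℝ) (hN : (Nᵀ * N).IsHermitian)
    (x : EuclideanSpace ℝ (Fin n)) :
    ‖(WithLp.toLp 2 (N *ᵥ x.ofLp) : EuclideanSpace ℝ (Fin p))‖ ^ 2 =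
      ∑ i, hN.eigenvalues i * inner ℝ (hN.eigenvectorBasis i) x ^ 2 := by
  have h1 : ‖(WithLp.toLp 2 (N *ᵥ x.ofLp) : EuclideanSpace ℝ (Fin p))‖ ^ 2 =
      inner ℝ x (WithLp.toLp 2 ((Nᵀ * N) *ᵥ x.ofLp) : EuclideanSpace ℝ (Fin n)) := by
    rw [← real_inner_self_eq_norm_sq, EuclideanSpace.inner_eq_star_dotProduct,
      EuclideanSpace.inner_eq_star_dotProduct]
    simp only [star_trivial]
    rw [← Matrix.mulVec_mulVec, dotProduct_comm _ x.ofLp, Matrix.dotProduct_mulVec,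
      Matrix.dotProduct_mulVec, Matrix.vecMul_transpose, ← Matrix.dotProduct_mulVec]
  rw [h1, ← hN.eigenvectorBasis.sum_inner_mul_inner]
  refine Finset.sum_congr rfl fun i _ => ?_
  have h2 : inner ℝ (hN.eigenvectorBasis i)
      (WithLp.toLp 2 ((Nᵀ * N) *ᵥ x.ofLp) : EuclideanSpace ℝ (Fin n)) =
      hN.eigenvalues i * inner ℝ (hN.eigenvectorBasis i) x := by
    have h3 := hN.mulVec_eigenvectorBasis i
    rw [EuclideanSpace.inner_eq_star_dotProduct, EuclideanSpace.inner_eq_star_dotProduct]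
    simp only [star_trivial]
    rw [dotProduct_comm, Matrix.dotProduct_mulVec, ← Matrix.mulVec_transpose,
      Matrix.transpose_mul, Matrix.transpose_transpose, h3, dotProduct_comm]
    simp
  rw [h2, real_inner_comm]
  ring

/-- The Gram determinant of the restriction to eigenvectors with eigenvalue above `θ`. -/
theorem exists_orthonormal_pow_le_det (N : Matrix (Fin p) (Fin n) ℝ) (hN : (Nᵀ * N).IsHermitian)
    {θ : ℝ} (hθ : 0 ≤ θ) :
    ∃ U : Matrix (Fin n) {i // θ < hN.eigenvalues i} ℝ, Uᵀ * U = 1 ∧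
      θ ^ Fintype.card {i // θ < hN.eigenvalues i} ≤ ((N * U)ᵀ * (N * U)).det := by
  set b := hN.eigenvectorBasis
  refine ⟨Matrix.of fun i c => b c.1 i, ?_, ?_⟩
  · ext c c'
    have := b.inner_eq_ite c'.1 c.1
    rw [EuclideanSpace.inner_eq_star_dotProduct] at this
    simp only [star_trivial] at this
    rw [Matrix.mul_apply, Matrix.one_apply]
    refine Eq.trans this ?_
    simp only [Subtype.ext_iff, eq_comm]
  · set U : Matrix (Fin n) {i // θ < hN.eigenvalues i} ℝ := Matrix.of fun i c => b c.1 i with hU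
    have h1 : (N * U)ᵀ * (N * U) = Matrix.diagonal fun c => hN.eigenvalues c.1 := by
      have h2 : (Nᵀ * N) * U = Matrix.of fun i c => hN.eigenvalues c.1 * b c.1 i := by
        ext i c
        exact congrFun (hN.mulVec_eigenvectorBasis c.1) i
      rw [Matrix.transpose_mul, Matrix.mul_assoc, ← Matrix.mul_assoc Nᵀ, h2]
      ext c c'
      have := b.inner_eq_ite c'.1 c.1
      rw [EuclideanSpace.inner_eq_star_dotProduct] at this
      simp only [star_trivial] at this
      have h3 : (Uᵀ * Matrix.of fun i (c : {i // θ < hN.eigenvalues i}) =>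
          hN.eigenvalues c.1 * b c.1 i) c c' =
          hN.eigenvalues c'.1 * ((b c.1).ofLp ⬝ᵥ (b c'.1).ofLp) := by
        rw [Matrix.mul_apply, dotProduct, Finset.mul_sum]
        refine Finset.sum_congr rfl fun i _ => ?_
        simp only [hU, Matrix.transpose_apply, Matrix.of_apply]
        ring
      rw [h3, this, Matrix.diagonal_apply]
      by_cases h : c = c'
      · subst h; simp
      · have : c'.1 ≠ c.1 := fun hc => h (Subtype.ext hc.symm)
        simp [h, this]
    rw [h1, Matrix.det_diagonal, ← Finset.card_univ, ← Finset.prod_const]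
    exact Finset.prod_le_prod (fun _ _ => hθ) fun c _ => c.2.le

end Spectral

theorem transpose_mul_self_mul_eq_one {ι ι' κ : Type*} [Fintype ι] [Fintype ι'] [DecidableEq ι']
    [DecidableEq κ] {V : Matrix ι ι' ℝ} {U : Matrix ι' κ ℝ} (hV : Vᵀ * V = 1) (hU : Uᵀ * U = 1) :
    (V * U)ᵀ * (V * U) = 1 := by
  rw [Matrix.transpose_mul, Matrix.mul_assoc, ← Matrix.mul_assoc Vᵀ, hV, Matrix.one_mul, hU]

/-! ### Eigenvalue constraints imposed by a short algorithm. -/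

namespace LinearAlgorithm
variable {m d n t : ℕ} {P : LinearAlgorithm d t} {A : Matrix (Fin m) (Fin d) ℝ}

theorem Computes.factorial_mul_pow_le (h : P.Computes A) (hP : P.CoeffBounded 1)
    {V : Matrix (Fin d) (Fin n) ℝ} (hV : Vᵀ * V = 1)
    (hN : ((A * V)ᵀ * (A * V)).IsHermitian) {θ : ℝ} (hθ : 0 ≤ θ) :
    (Fintype.card {i // θ < hN.eigenvalues i}).factorial *
      θ ^ Fintype.card {i // θ < hN.eigenvalues i} ≤
      (m : ℝ) ^ Fintype.card {i // θ < hN.eigenvalues i} * 4 ^ t := by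
  obtain ⟨U, hU, hdet⟩ := exists_orthonormal_pow_le_det (A * V) hN hθ
  have := h.factorial_mul_det_le hP (transpose_mul_self_mul_eq_one hV hU)
  rw [show A * (V * U) = A * V * U from (Matrix.mul_assoc A V U).symm] at this
  exact (mul_le_mul_of_nonneg_left hdet (Nat.cast_nonneg _)).trans this

/-- The coordinates hit by at most one unit-vector row: outside the span of the `t` computed
registers, a computed matrix does not expand vectors supported on them. -/
theorem Computes.exists_finset_window (h : P.Computes A) (hmd : m ≤ d) :
    ∃ S : Finset (Fin d), d ≤ 2 * S.card ∧ ∀ (e : Fin n → Fin d), Function.Injective e →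
      ∀ hN : ((A * (1 : Matrix (Fin d) (Fin d) ℝ).submatrix id e)ᵀ *
        (A * (1 : Matrix (Fin d) (Fin d) ℝ).submatrix id e)).IsHermitian,
      (Finset.univ.filter fun i => e i ∈ S).card ≤
        t + (Finset.univ.filter fun i => hN.eigenvalues i ≤ 1).card := by
  classical
  obtain ⟨k, hk⟩ := h.exists_rows_eq
  -- `p j` counts the copies of input `j` among the rows; the total is at most `m ≤ d`, so at least
  -- half of the inputs have `p j ≤ 1`.
  set p : Fin d → ℕ := fun j => (Finset.univ.filter fun i => A i = (1 : Matrix _ _ ℝ) j).card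
    with hp
  have hone : Function.Injective (1 : Matrix (Fin d) (Fin d) ℝ) := by
    intro i j hij
    by_contra hne
    have := congrFun hij i
    rw [Matrix.one_apply_eq, Matrix.one_apply_ne (Ne.symm hne)] at this
    exact one_ne_zero this
  have hpsum : ∑ j, p j ≤ m := by
    simp only [hp, Finset.card_filter]
    rw [Finset.sum_comm]
    calc _ ≤ ∑ _i : Fin m, 1 := by
          refine Finset.sum_le_sum fun i _ => ?_
          rw [← Finset.card_filter, Finset.card_le_one]
          intro a ha c hc
          simp only [Finset.mem_filter, Finset.mem_univ, true_and] at ha hc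
          exact hone (ha.symm.trans hc)
      _ = m := by simp
  set S := Finset.univ.filter fun j => p j ≤ 1 with hS
  refine ⟨S, ?_, ?_⟩
  · have h1 : 2 * Sᶜ.card ≤ ∑ j, p j := by
      calc 2 * Sᶜ.card = ∑ _j ∈ Sᶜ, 2 := by simp [mul_comm]
        _ ≤ ∑ j ∈ Sᶜ, p j := Finset.sum_le_sum fun j hj => by
            simp [hS] at hj; omega
        _ ≤ _ := Finset.sum_le_sum_of_subset (Finset.subset_univ _)
    have h2 := Finset.card_add_card_compl S
    rw [Fintype.card_fin] at h2
    omega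
  · intro e he
    generalize hV : (1 : Matrix (Fin d) (Fin d) ℝ).submatrix id e = V
    intro hN
    by_contra hlt
    push Not at hlt
    -- If the inequality fails, these are fewer than `n` conditions: vanishing on the computed
    -- registers, off `S`, and along eigenvectors with eigenvalue at most one. A nonzero common
    -- solution is strictly expanded by `A * V`, contrary to `hle`.
    let Lm : EuclideanSpace ℝ (Fin n) →ₗ[ℝ]
        (Fin t ⊕ {i // e i ∉ S} ⊕ {i // hN.eigenvalues i ≤ 1} → ℝ) :=
      LinearMap.pi (Sum.elim
        (fun l => (LinearMap.proj (Fin.natAdd (d + 1) l)).comp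
          ((P.rows * V).mulVecLin.comp (WithLp.linearEquiv 2 ℝ (Fin n → ℝ)).toLinearMap))
        (Sum.elim (fun i => (LinearMap.proj i.1).comp
            (WithLp.linearEquiv 2 ℝ (Fin n → ℝ)).toLinearMap)
          fun i => (innerₛₗ ℝ (hN.eigenvectorBasis i.1))))
    have hdim : Module.finrank ℝ (Fin t ⊕ {i // e i ∉ S} ⊕ {i // hN.eigenvalues i ≤ 1} → ℝ) <
        Module.finrank ℝ (EuclideanSpace ℝ (Fin n)) := by
      have h2 := Finset.card_filter_add_card_filter_not (s := (Finset.univ : Finset (Fin n)))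
        (fun i => e i ∈ S)
      simp only [Finset.card_univ, Fintype.card_fin] at h2
      simp only [Module.finrank_fintype_fun_eq_card, Fintype.card_sum, Fintype.card_fin,
        finrank_euclideanSpace, Fintype.card_subtype]
      omega
    obtain ⟨v, hv, hv0⟩ := (Submodule.ne_bot_iff _).1 (LinearMap.ker_ne_bot_of_finrank_lt hdim)
    have hL : ∀ q, Lm v q = 0 := fun q => congrFun (LinearMap.mem_ker.1 hv) q
    have hcomp : ∀ l : Fin t, ((P.rows * V) *ᵥ v.ofLp) (Fin.natAdd (d + 1) l) = 0 :=
      fun l => hL (Sum.inl l)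
    have hsupp : ∀ i, e i ∉ S → v.ofLp i = 0 := fun i hi => hL (Sum.inr (Sum.inl ⟨i, hi⟩))
    have hinner : ∀ i, hN.eigenvalues i ≤ 1 → inner ℝ (hN.eigenvectorBasis i) v = 0 :=
      fun i hi => hL (Sum.inr (Sum.inr ⟨i, hi⟩))
    have hgt : ‖v‖ ^ 2 < ‖(WithLp.toLp 2 ((A * V) *ᵥ v.ofLp) : EuclideanSpace ℝ (Fin m))‖ ^ 2 := by
      rw [norm_sq_toLp_mulVec (A * V) hN, hN.eigenvectorBasis.norm_sq_eq_sum]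
      have hex : ∃ i, inner ℝ (hN.eigenvectorBasis i) v ≠ 0 := by
        by_contra hc
        push Not at hc
        apply hv0
        rw [← norm_eq_zero, ← sq_eq_zero_iff, hN.eigenvectorBasis.norm_sq_eq_sum]
        exact Finset.sum_eq_zero fun i _ => by rw [hc i, zero_pow two_ne_zero]
      obtain ⟨i, hi⟩ := hex
      refine Finset.sum_lt_sum (fun i _ => ?_) ⟨i, Finset.mem_univ _, ?_⟩
      · by_cases h1 : hN.eigenvalues i ≤ 1
        · rw [hinner i h1, zero_pow two_ne_zero, mul_zero]
        · nlinarith [sq_nonneg (inner ℝ (hN.eigenvectorBasis i) v)]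
      · have h1 : 1 < hN.eigenvalues i := by
          by_contra h1
          exact hi (hinner i (not_lt.1 h1))
        have : 0 < inner ℝ (hN.eigenvectorBasis i) v ^ 2 := by positivity
        nlinarith
    set y := V *ᵥ v.ofLp with hy
    have hyS : ∀ j, j ∉ S → y j = 0 := by
      intro j hj
      rw [hy, Matrix.mulVec, dotProduct]
      refine Finset.sum_eq_zero fun i _ => ?_
      by_cases hij : j = e i
      · rw [hsupp i (hij ▸ hj), mul_zero]
      · rw [← hV, Matrix.submatrix_apply, id, Matrix.one_apply_ne hij, zero_mul]
    have hye : ∀ i, y (e i) = v.ofLp i := by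
      intro i
      rw [hy, Matrix.mulVec, dotProduct, Finset.sum_eq_single i]
      · rw [← hV, Matrix.submatrix_apply, id, Matrix.one_apply_eq, one_mul]
      · intro i' _ hne
        rw [← hV, Matrix.submatrix_apply, id, Matrix.one_apply_ne (fun hc => hne (he hc).symm),
          zero_mul]
      · simp
    have hynot : ∀ j, j ∉ Set.range e → y j = 0 := by
      intro j hj
      rw [hy, Matrix.mulVec, dotProduct]
      refine Finset.sum_eq_zero fun i _ => ?_
      rw [← hV, Matrix.submatrix_apply, id, Matrix.one_apply_ne (fun hc => hj ⟨i, hc.symm⟩),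
        zero_mul]
    have hynorm : ∑ j, y j ^ 2 = ‖v‖ ^ 2 := by
      rw [EuclideanSpace.norm_sq_eq]
      simp only [Real.norm_eq_abs, sq_abs]
      rw [← Fintype.sum_of_injective e he (fun i => v.ofLp i ^ 2) (fun j => y j ^ 2)]
      · intro j hj
        simp [hynot j hj]
      · intro i
        rw [hye]
    -- A row from a computed register kills `y`; a row from an initial register is zero or reads off
    -- one coordinate.
    have hrow : ∀ i, (A *ᵥ y) i ^ 2 ≤ ∑ j, if A i = (1 : Matrix _ _ ℝ) j then y j ^ 2 else 0 := by
      intro i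
      have hnn : 0 ≤ ∑ j, if A i = (1 : Matrix _ _ ℝ) j then y j ^ 2 else 0 :=
        Finset.sum_nonneg fun j _ => by split_ifs <;> positivity
      by_cases hki : (k i : ℕ) < d + 1
      · rcases P.rows_of_lt (k i) hki with h0 | ⟨j, hj⟩
        · have : (A *ᵥ y) i = 0 := by
            rw [Matrix.mulVec, hk, h0, zero_dotProduct]
          rw [this]
          simpa using hnn
        · have h1 : (A *ᵥ y) i = y j := by
            rw [Matrix.mulVec, hk, hj]
            exact congrFun (Matrix.one_mulVec y) j
          rw [h1]
          refine le_trans (le_of_eq ?_) (Finset.single_le_sum (fun j _ => ?_) (Finset.mem_univ j))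
          · rw [if_pos (by rw [hk, hj])]
          · split_ifs <;> positivity
      · have h1 : (A *ᵥ y) i = 0 := by
          have h2 := hcomp ⟨(k i : ℕ) - (d + 1), by omega⟩
          have h3 : Fin.natAdd (d + 1) (⟨(k i : ℕ) - (d + 1), by omega⟩ : Fin t) = k i := by
            ext
            simp
            omega
          rw [h3, ← Matrix.mulVec_mulVec] at h2
          rw [Matrix.mulVec, hk]
          exact h2
        rw [h1]
        simpa using hnn
    have hle : ‖(WithLp.toLp 2 ((A * V) *ᵥ v.ofLp) : EuclideanSpace ℝ (Fin m))‖ ^ 2 ≤ ‖v‖ ^ 2 := by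
      rw [EuclideanSpace.norm_sq_eq, ← hynorm, ← Matrix.mulVec_mulVec]
      simp only [Real.norm_eq_abs, sq_abs]
      calc _ ≤ ∑ i, ∑ j, (if A i = (1 : Matrix _ _ ℝ) j then y j ^ 2 else 0) :=
            Finset.sum_le_sum fun i _ => hrow i
        _ = ∑ j, (p j : ℝ) * y j ^ 2 := by
            rw [Finset.sum_comm]
            refine Finset.sum_congr rfl fun j _ => ?_
            simp only [hp, Finset.card_filter]
            push_cast
            rw [Finset.sum_mul]
            exact Finset.sum_congr rfl fun i _ => by rw [ite_mul, one_mul, zero_mul]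
        _ ≤ ∑ j, y j ^ 2 := by
            refine Finset.sum_le_sum fun j _ => ?_
            by_cases hj : j ∈ S
            · have : (p j : ℝ) ≤ 1 := by
                exact_mod_cast (Finset.mem_filter.1 hj).2
              nlinarith [sq_nonneg (y j)]
            · simp [hyS j hj]
    exact absurd hgt (not_lt.2 hle)

end LinearAlgorithm

/-! ### Cyclic windows of coordinates. -/

/-- The cyclic window of length `n` in `Fin d` starting at `τ`. -/
def cyclicWindow {n d : ℕ} [NeZero d] (h : n ≤ d) (τ : Fin d) (i : Fin n) : Fin d :=
  τ + Fin.castLE h i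

theorem cyclicWindow_injective {n d : ℕ} [NeZero d] (h : n ≤ d) (τ : Fin d) :
    Function.Injective (cyclicWindow h τ) := fun _ _ hij =>
  Fin.castLE_injective h (add_left_cancel hij)

/-- If at least half of `Fin d` is marked, then some window, avoiding few exceptional ones, is
marked to at least a quarter. -/
theorem exists_cyclicWindow_card_le {n d : ℕ} [NeZero d] (h : n ≤ d) (hn : 0 < n)
    {S N : Finset (Fin d)} (hS : d ≤ 2 * S.card) (hN : 8 * N.card ≤ d) :
    ∃ τ, τ ∉ N ∧ n ≤ 4 * (Finset.univ.filter fun i => cyclicWindow h τ i ∈ S).card := by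
  classical
  by_contra! hcon
  have hsum : ∑ τ, (Finset.univ.filter fun i => cyclicWindow h τ i ∈ S).card = n * S.card := by
    simp only [Finset.card_filter]
    rw [Finset.sum_comm]
    have : ∀ i : Fin n, ∑ τ, (if cyclicWindow h τ i ∈ S then 1 else 0) = S.card := by
      intro i
      refine (Equiv.sum_comp (Equiv.addRight (Fin.castLE h i))
        (fun j => if j ∈ S then 1 else 0)).trans ?_
      simp
    simp [this]
  -- Exceptional windows are bounded trivially by `n`. The total is at most `(1 + 3 / 8) * n * d`,
  -- whereas `hsum` and `hS` make it at least `2 * n * d`.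
  have hbd : ∑ τ, 4 * (Finset.univ.filter fun i => cyclicWindow h τ i ∈ S).card ≤
      ∑ τ, (n + if τ ∈ N then 3 * n else 0) := by
    refine Finset.sum_le_sum fun τ _ => ?_
    have h1 : (Finset.univ.filter fun i => cyclicWindow h τ i ∈ S).card ≤ n :=
      (Finset.card_filter_le _ _).trans (by simp)
    by_cases hτ : τ ∈ N
    · simp only [hτ, if_true]; omega
    · simp only [hτ, if_false]; exact (hcon τ hτ).le
  rw [← Finset.mul_sum, hsum, Finset.sum_add_distrib] at hbd
  simp at hbd
  have hd : 0 < d := Nat.pos_of_ne_zero (NeZero.ne d)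
  have hnd : 0 < n * d := Nat.mul_pos hn hd
  nlinarith

/-- The matrix embedding `ℝⁿ` into `ℝᵈ` along the cyclic window at `τ`. -/
def windowMatrix {n d : ℕ} [NeZero d] (h : n ≤ d) (τ : Fin d) : Matrix (Fin d) (Fin n) ℝ :=
  (1 : Matrix (Fin d) (Fin d) ℝ).submatrix id (cyclicWindow h τ)

theorem windowMatrix_transpose_mul_self {n d : ℕ} [NeZero d] (h : n ≤ d) (τ : Fin d) :
    (windowMatrix h τ)ᵀ * windowMatrix h τ = 1 := by
  rw [windowMatrix, Matrix.transpose_submatrix, ← Matrix.submatrix_mul _ _ _ id _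
    Function.bijective_id, Matrix.transpose_one, Matrix.one_mul,
    Matrix.submatrix_one _ (cyclicWindow_injective h τ)]

theorem norm_toLp_mulVec_of_transpose_mul_self {d n : ℕ} {V : Matrix (Fin d) (Fin n) ℝ}
    (hV : Vᵀ * V = 1) (x : EuclideanSpace ℝ (Fin n)) :
    ‖(WithLp.toLp 2 (V *ᵥ x.ofLp) : EuclideanSpace ℝ (Fin d))‖ = ‖x‖ := by
  rw [← sq_eq_sq₀ (norm_nonneg _) (norm_nonneg _), ← real_inner_self_eq_norm_sq,
    ← real_inner_self_eq_norm_sq, EuclideanSpace.inner_eq_star_dotProduct,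
    EuclideanSpace.inner_eq_star_dotProduct]
  simp only [star_trivial]
  rw [Matrix.dotProduct_mulVec, ← Matrix.mulVec_transpose, Matrix.mulVec_mulVec, hV,
    Matrix.one_mulVec]

/-! ### Distortion of Gaussian vectors by a random matrix. -/

/-- The vectors whose norm the scaled matrix `s^{-1/2} A` distorts by more than a factor `1 ± ε`. -/
def distortedVectors {m d : ℕ} (ε : ℝ) (s : ℕ) (A : Matrix (Fin m) (Fin d) ℝ) :
    Set (EuclideanSpace ℝ (Fin d)) :=
  {x | ‖(√(s : ℝ))⁻¹ • (WithLp.toLp 2 (A *ᵥ x.ofLp) : EuclideanSpace ℝ (Fin m))‖ ∉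
    Set.Icc ((1 - ε) * ‖x‖) ((1 + ε) * ‖x‖)}

theorem measurableSet_distortedVectors_comp {m d n : ℕ} (ε : ℝ) (s : ℕ)
    {V : Matrix (Fin d) (Fin n) ℝ} (hV : Vᵀ * V = 1) :
    MeasurableSet {q : Matrix (Fin m) (Fin d) ℝ × EuclideanSpace ℝ (Fin n) |
      WithLp.toLp 2 (V *ᵥ q.2.ofLp) ∈ distortedVectors ε s q.1} := by
  have hf : Measurable fun q : Matrix (Fin m) (Fin d) ℝ × EuclideanSpace ℝ (Fin n) =>
      ‖(√(s : ℝ))⁻¹ • (WithLp.toLp 2 (q.1 *ᵥ (V *ᵥ q.2.ofLp)) : EuclideanSpace ℝ (Fin m))‖ := by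
    simp only [norm_smul, EuclideanSpace.norm_eq, Matrix.mulVec, dotProduct]
    refine Measurable.const_mul (Measurable.sqrt (Finset.measurable_sum _ fun i _ =>
      (Measurable.norm (Finset.measurable_sum _ fun j _ => Measurable.mul ?_
        (Finset.measurable_sum _ fun l _ => ?_))).pow_const 2)) _
    · have h1 : Measurable fun A : Matrix (Fin m) (Fin d) ℝ => A i j :=
        (measurable_pi_apply j).comp
          (measurable_pi_apply (X := fun _ : Fin m => Fin d → ℝ) i)
      exact h1.comp measurable_fst
    · fun_prop
  have hg : Measurable fun q : Matrix (Fin m) (Fin d) ℝ × EuclideanSpace ℝ (Fin n) => ‖q.2‖ :=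
    measurable_snd.norm
  have e : {q : Matrix (Fin m) (Fin d) ℝ × EuclideanSpace ℝ (Fin n) |
      WithLp.toLp 2 (V *ᵥ q.2.ofLp) ∈ distortedVectors ε s q.1} =
      ({q | (1 - ε) * ‖q.2‖ ≤ ‖(√(s : ℝ))⁻¹ • (WithLp.toLp 2 (q.1 *ᵥ (V *ᵥ q.2.ofLp)) :
          EuclideanSpace ℝ (Fin m))‖} ∩
        {q | ‖(√(s : ℝ))⁻¹ • (WithLp.toLp 2 (q.1 *ᵥ (V *ᵥ q.2.ofLp)) :
          EuclideanSpace ℝ (Fin m))‖ ≤ (1 + ε) * ‖q.2‖})ᶜ := by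
    ext q
    simp [distortedVectors, norm_toLp_mulVec_of_transpose_mul_self hV]
  rw [e]
  exact ((measurableSet_le (hg.const_mul _) hf).inter (measurableSet_le hf (hg.const_mul _))).compl

/-- If the Gram matrix of `A V` has many small eigenvalues, then `A` distorts the norm of a
Gaussian vector in the range of `V` with non-negligible probability. -/
theorem le_gaussianVec_distortedVectors {m d n : ℕ} (hn : 0 < n) {ε : ℝ} (hε : 0 < ε)
    (hε' : ε ≤ 1 / 4) {s : ℕ} (hs : 0 < s) {A : Matrix (Fin m) (Fin d) ℝ}
    {V : Matrix (Fin d) (Fin n) ℝ} (hV : Vᵀ * V = 1)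
    (hN : ((A * V)ᵀ * (A * V)).IsHermitian)
    (hcard : n ≤ 8 * (Finset.univ.filter fun i => hN.eigenvalues i ≤ s / 2).card) :
    ENNReal.ofReal (Real.exp (-((3000000 * ε) ^ 2 / 2 * n)) / 4) ≤
      gaussianVec (EuclideanSpace ℝ (Fin n))
        {x | WithLp.toLp 2 (V *ᵥ x.ofLp) ∈ distortedVectors ε s A} := by
  have hs' : (0 : ℝ) < s := by exact_mod_cast hs
  have : Nonempty (Fin n) := ⟨⟨0, hn⟩⟩
  have h := le_gaussianVec_distorted hN.eigenvectorBasis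
    (lam := fun i => (s : ℝ)⁻¹ * hN.eigenvalues i) (by
      rw [Fintype.card_fin]
      refine hcard.trans (le_of_eq ?_)
      congr 2
      ext i
      simp only [Finset.mem_filter, Finset.mem_univ, true_and]
      rw [inv_mul_le_iff₀ hs']
      ring_nf) hε hε'
  rw [Fintype.card_fin] at h
  refine h.trans (measure_mono fun x hx => ?_)
  have hsq : ∑ i, (s : ℝ)⁻¹ * hN.eigenvalues i * inner ℝ (hN.eigenvectorBasis i) x ^ 2 =
      ‖(√(s : ℝ))⁻¹ • (WithLp.toLp 2 (A *ᵥ (V *ᵥ x.ofLp)) : EuclideanSpace ℝ (Fin m))‖ ^ 2 := by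
    rw [norm_smul, mul_pow, Matrix.mulVec_mulVec, norm_sq_toLp_mulVec (A * V) hN, Finset.mul_sum,
      norm_inv, inv_pow, Real.norm_eq_abs, sq_abs, Real.sq_sqrt hs'.le]
    exact Finset.sum_congr rfl fun i _ => by ring
  rw [Set.mem_ofPred_eq, hsq] at hx
  simp only [Set.mem_ofPred_eq, distortedVectors, norm_toLp_mulVec_of_transpose_mul_self hV]
  intro hmem
  apply hx
  rw [← mul_pow, ← mul_pow]
  have h1 : 0 ≤ (1 - ε) * ‖x‖ := mul_nonneg (by linarith) (norm_nonneg _)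
  exact ⟨pow_le_pow_left₀ h1 hmem.1 2, pow_le_pow_left₀ (norm_nonneg _) hmem.2 2⟩

/-- The total Gaussian measure, over all windows, of the vectors that `A` distorts. -/
noncomputable def windowDistortion {m d : ℕ} [NeZero d] (ε : ℝ) (s : ℕ) {n : ℕ} (h : n ≤ d)
    (A : Matrix (Fin m) (Fin d) ℝ) : ℝ≥0∞ :=
  ∑ τ : Fin d, gaussianVec (EuclideanSpace ℝ (Fin n))
    {x | WithLp.toLp 2 (windowMatrix h τ *ᵥ x.ofLp) ∈ distortedVectors ε s A}

theorem measurable_gaussianVec_distortedVectors {m d n : ℕ} (ε : ℝ) (s : ℕ)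
    {V : Matrix (Fin d) (Fin n) ℝ} (hV : Vᵀ * V = 1) :
    Measurable fun A : Matrix (Fin m) (Fin d) ℝ => gaussianVec (EuclideanSpace ℝ (Fin n))
      {x | WithLp.toLp 2 (V *ᵥ x.ofLp) ∈ distortedVectors ε s A} :=
  measurable_measure_prodMk_left (measurableSet_distortedVectors_comp ε s hV)

theorem measurable_windowDistortion {m d : ℕ} [NeZero d] (ε : ℝ) (s : ℕ) {n : ℕ} (h : n ≤ d) :
    Measurable (windowDistortion (m := m) ε s h) :=
  Finset.measurable_sum _ fun τ _ => measurable_gaussianVec_distortedVectors ε s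
    (windowMatrix_transpose_mul_self h τ)

/-- Fubini: the guarantee for each fixed vector passes to an independent Gaussian vector. -/
theorem IsScaledJL.lintegral_gaussianVec_le {m d n s : ℕ} {ε δ : ℝ}
    {μ : Measure (Matrix (Fin m) (Fin d) ℝ)} (hμ : IsScaledJL μ ε δ s)
    {V : Matrix (Fin d) (Fin n) ℝ} (hV : Vᵀ * V = 1) :
    ∫⁻ A, gaussianVec (EuclideanSpace ℝ (Fin n))
      {x | WithLp.toLp 2 (V *ᵥ x.ofLp) ∈ distortedVectors ε s A} ∂μ ≤ ENNReal.ofReal δ := by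
  have := hμ.isProbabilityMeasure
  have hmeas := measurableSet_distortedVectors_comp (m := m) ε s hV
  have h1 := Measure.prod_apply (μ := μ) (ν := gaussianVec (EuclideanSpace ℝ (Fin n))) hmeas
  have h2 := Measure.prod_apply_symm (μ := μ) (ν := gaussianVec (EuclideanSpace ℝ (Fin n))) hmeas
  refine (h1.symm.trans h2).trans_le ?_
  calc _ ≤ ∫⁻ _x, ENNReal.ofReal δ ∂gaussianVec (EuclideanSpace ℝ (Fin n)) :=
        lintegral_mono fun x => (hμ.preserves (WithLp.toLp 2 (V *ᵥ x.ofLp))).le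
    _ = ENNReal.ofReal δ := by rw [lintegral_const, measure_univ, mul_one]

theorem IsScaledJL.lintegral_windowDistortion_le {m d s : ℕ} [NeZero d] {ε δ : ℝ}
    {μ : Measure (Matrix (Fin m) (Fin d) ℝ)} (hμ : IsScaledJL μ ε δ s) {n : ℕ} (h : n ≤ d) :
    ∫⁻ A, windowDistortion ε s h A ∂μ ≤ d * ENNReal.ofReal δ := by
  unfold windowDistortion
  rw [lintegral_finsetSum _ fun τ _ => measurable_gaussianVec_distortedVectors ε s
    (windowMatrix_transpose_mul_self h τ)]
  calc _ ≤ ∑ _τ : Fin d, ENNReal.ofReal δ := Finset.sum_le_sum fun τ _ =>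
        hμ.lintegral_gaussianVec_le (windowMatrix_transpose_mul_self h τ)
    _ = _ := by simp

/-- Markov's inequality for the sum over all windows, so that a single event allows the window to be
chosen depending on `A`. -/
theorem IsScaledJL.half_le_measure {m d s : ℕ} [NeZero d] {ε δ : ℝ}
    {μ : Measure (Matrix (Fin m) (Fin d) ℝ)} (hμ : IsScaledJL μ ε δ s) {n : ℕ} (h : n ≤ d) :
    1 / 2 ≤ μ {A | windowDistortion ε s h A < 2 * (d * ENNReal.ofReal δ)} := by
  have := hμ.isProbabilityMeasure
  have hd : (d : ℝ≥0∞) ≠ 0 := by exact_mod_cast NeZero.ne d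
  have hδ : ENNReal.ofReal δ ≠ 0 := by simpa using hμ.delta_pos
  set K := (d : ℝ≥0∞) * ENNReal.ofReal δ with hK
  have hK0 : K ≠ 0 := mul_ne_zero hd hδ
  have hKtop : K ≠ ∞ := ENNReal.mul_ne_top (ENNReal.natCast_ne_top d) ENNReal.ofReal_ne_top
  have hmark := mul_meas_ge_le_lintegral (μ := μ) (measurable_windowDistortion (m := m) ε s h)
    (2 * K)
  have h1 : μ {A | 2 * K ≤ windowDistortion ε s h A} ≤ 1 / 2 := by
    have h2 := hmark.trans (hμ.lintegral_windowDistortion_le h)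
    rw [← hK, mul_right_comm, mul_comm _ K] at h2
    have h3 := (ENNReal.mul_le_mul_iff_right hK0 hKtop).1 (h2.trans (mul_one K).symm.le)
    rw [ENNReal.le_div_iff_mul_le (by simp) (by simp), mul_comm]
    exact h3
  have hms : MeasurableSet {A : Matrix (Fin m) (Fin d) ℝ | 2 * K ≤ windowDistortion ε s h A} :=
    measurableSet_le measurable_const (measurable_windowDistortion ε s h)
  have h4 := prob_compl_eq_one_sub (μ := μ) hms
  have h5 : {A : Matrix (Fin m) (Fin d) ℝ | 2 * K ≤ windowDistortion ε s h A}ᶜ =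
      {A | windowDistortion ε s h A < 2 * K} := by
    ext A; simp
  rw [← h5, h4]
  calc (1 / 2 : ℝ≥0∞) = 1 - 1 / 2 := by simp
    _ ≤ _ := tsub_le_tsub_left h1 1

theorem windowMatrix_isHermitian {m d n : ℕ} [NeZero d] (h : n ≤ d)
    (A : Matrix (Fin m) (Fin d) ℝ) (τ : Fin d) :
    ((A * windowMatrix h τ)ᵀ * (A * windowMatrix h τ)).IsHermitian := by
  simpa using Matrix.isHermitian_conjTranspose_mul_self (A * windowMatrix h τ)

/-- Unless the distortion is large, few windows carry many small eigenvalues. -/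
theorem card_bad_windows_le {m d n : ℕ} [NeZero d] (h : n ≤ d) (hn : 0 < n) {ε δ : ℝ}
    (hε : 0 < ε) (hε' : ε ≤ 1 / 4) (hδ : 0 < δ) {s : ℕ} (hs : 0 < s)
    (hδn : 64 * δ ≤ Real.exp (-((3000000 * ε) ^ 2 / 2 * n)))
    {A : Matrix (Fin m) (Fin d) ℝ}
    (hA : windowDistortion ε s h A < 2 * (d * ENNReal.ofReal δ)) :
    8 * (Finset.univ.filter fun τ => n ≤ 8 * (Finset.univ.filter fun i =>
      (windowMatrix_isHermitian h A τ).eigenvalues i ≤ s / 2).card).card ≤ d := by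
  set N := Finset.univ.filter fun τ => n ≤ 8 * (Finset.univ.filter fun i =>
      (windowMatrix_isHermitian h A τ).eigenvalues i ≤ s / 2).card with hN
  -- Each bad window contributes at least `16 * δ`, so a total below `2 * d * δ` leaves room for
  -- fewer than `d / 8` of them.
  have h1 : (N.card : ℝ≥0∞) * ENNReal.ofReal (16 * δ) ≤ windowDistortion ε s h A := by
    calc _ = ∑ _τ ∈ N, ENNReal.ofReal (16 * δ) := by simp
      _ ≤ ∑ τ ∈ N, gaussianVec (EuclideanSpace ℝ (Fin n))
          {x | WithLp.toLp 2 (windowMatrix h τ *ᵥ x.ofLp) ∈ distortedVectors ε s A} := by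
          refine Finset.sum_le_sum fun τ hτ => ?_
          refine le_trans (ENNReal.ofReal_le_ofReal ?_) (le_gaussianVec_distortedVectors hn hε hε' hs
            (windowMatrix_transpose_mul_self h τ) (windowMatrix_isHermitian h A τ)
            (Finset.mem_filter.1 hτ).2)
          linarith
      _ ≤ _ := Finset.sum_le_sum_of_subset (Finset.subset_univ _)
  have h2 := h1.trans_lt hA
  rw [← ENNReal.ofReal_natCast, ← ENNReal.ofReal_natCast, ← ENNReal.ofReal_mul (by positivity),
    ← ENNReal.ofReal_mul (by positivity), ← ENNReal.ofReal_ofNat,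
    ← ENNReal.ofReal_mul (by positivity)] at h2
  have h3 := (ENNReal.ofReal_lt_ofReal_iff_of_nonneg (by positivity)).1 h2
  have h4 : (8 * N.card : ℝ) < d := by
    by_contra hc
    push Not at hc
    nlinarith
  exact_mod_cast h4.le

/-! ### From the two step bounds to the expectation. -/

/-- The two lower bounds on the number of steps used for a typical matrix. -/
theorem LinearAlgorithm.Computes.lower_bounds {m d n t s : ℕ} [NeZero d] {P : LinearAlgorithm d t}
    {A : Matrix (Fin m) (Fin d) ℝ} (hc : P.Computes A) (hP : P.CoeffBounded 1) (hmd : m ≤ d)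
    (h : n ≤ d) (hn : 0 < n) (hs : 2 ≤ s)
    (hbad : 8 * (Finset.univ.filter fun τ => n ≤ 8 * (Finset.univ.filter fun i =>
      (windowMatrix_isHermitian h A τ).eigenvalues i ≤ s / 2).card).card ≤ d) :
    n ≤ 8 * t ∧ ∃ k : ℕ, n ≤ 2 * k ∧
      (k.factorial : ℝ) * ((s : ℝ) / 2) ^ k ≤ (m : ℝ) ^ k * 4 ^ t := by
  have hs' : (2 : ℝ) ≤ s := by exact_mod_cast hs
  obtain ⟨S, hS, hSw⟩ := hc.exists_finset_window (n := n) hmd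
  obtain ⟨τ, hτ, hτS⟩ := exists_cyclicWindow_card_le h hn hS hbad
  simp only [Finset.mem_filter, Finset.mem_univ, true_and, not_le] at hτ
  set hN := windowMatrix_isHermitian h A τ
  constructor
  · have h1 : (Finset.univ.filter fun i => cyclicWindow h τ i ∈ S).card ≤
        t + (Finset.univ.filter fun i => hN.eigenvalues i ≤ 1).card :=
      hSw _ (cyclicWindow_injective h τ) hN
    have h2 : (Finset.univ.filter fun i => hN.eigenvalues i ≤ 1).card ≤
        (Finset.univ.filter fun i => hN.eigenvalues i ≤ s / 2).card :=
      Finset.card_le_card (Finset.monotone_filter_right _ fun i _ hi => by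
        have : hN.eigenvalues i ≤ 1 := hi
        show hN.eigenvalues i ≤ s / 2
        linarith)
    omega
  · refine ⟨_, ?_, hc.factorial_mul_pow_le hP (windowMatrix_transpose_mul_self h τ) hN
      (θ := s / 2) (by linarith)⟩
    have h2 := Finset.card_filter_add_card_filter_not (s := (Finset.univ : Finset (Fin n)))
      (fun i => hN.eigenvalues i ≤ s / 2)
    simp only [Finset.card_univ, Fintype.card_fin, not_le] at h2
    rw [Fintype.card_subtype]
    omega

/-- Two regimes. If `log s ≤ 2 * log (12 / c)`, the bound `n ≤ 8 * t` suffices. Otherwise `k ^ k ≤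
exp k * k!` turns the determinant bound into `k * log s ≤ k * log (12 / c) + 2 * t`, whose first
right-hand term is at most half of the left side. -/
theorem mul_log_le_of_step_bounds {m n t k s : ℕ} {c : ℝ} (hc : 0 < c) (hc1 : c ≤ 1) (hm : 0 < m)
    (hn : c * m ≤ n) (hs : 2 ≤ s) (hnt : n ≤ 8 * t) (hnk : n ≤ 2 * k)
    (hk : (k.factorial : ℝ) * ((s : ℝ) / 2) ^ k ≤ (m : ℝ) ^ k * 4 ^ t) :
    c / (16 * Real.log (12 / c)) * (m * Real.log s) ≤ t := by
  have hm' : (0 : ℝ) < m := by exact_mod_cast hm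
  have hs' : (2 : ℝ) ≤ s := by exact_mod_cast hs
  have hnt' : (n : ℝ) ≤ 8 * t := by exact_mod_cast hnt
  have hnk' : (n : ℝ) ≤ 2 * k := by exact_mod_cast hnk
  have hcm : 0 < c * m := mul_pos hc hm'
  have hk' : (0 : ℝ) < k := by linarith
  have hexp3 : Real.exp 1 < 3 := Real.exp_one_lt_d9.trans (by norm_num)
  set l := Real.log (12 / c) with hl
  have hl1 : 1 ≤ l := by
    rw [hl, Real.le_log_iff_exp_le (by positivity)]
    have : 12 ≤ 12 / c := by
      rw [le_div_iff₀ hc]; linarith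
    linarith
  rw [div_mul_eq_mul_div, div_le_iff₀ (by positivity)]
  rcases le_total (Real.log s) (2 * l) with hsl | hsl
  · calc c * (m * Real.log s) = c * m * Real.log s := by ring
      _ ≤ c * m * (2 * l) := by gcongr
      _ ≤ 8 * t * (2 * l) := by
          refine mul_le_mul_of_nonneg_right (by linarith) (by positivity)
      _ = t * (16 * l) := by ring
  · have h1 := Real.pow_div_factorial_le_exp _ hk'.le k
    rw [div_le_iff₀ (by positivity)] at h1
    have h2 : (k : ℝ) ^ k * (s / 2) ^ k ≤ Real.exp k * ((m : ℝ) ^ k * 4 ^ t) := by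
      calc _ ≤ Real.exp k * k.factorial * (s / 2) ^ k := by gcongr
        _ = Real.exp k * (k.factorial * (s / 2) ^ k) := by ring
        _ ≤ _ := by gcongr
    have h3 := Real.log_le_log (by positivity) h2
    rw [Real.log_mul (by positivity) (by positivity), Real.log_mul (by positivity) (by positivity),
      Real.log_mul (by positivity) (by positivity), Real.log_pow, Real.log_pow, Real.log_pow,
      Real.log_pow, Real.log_exp, Real.log_div (by positivity) (by positivity)] at h3
    -- Source of the `12`: from `m ≤ 2 * k / c` one gets `2 * e * m ≤ 4 * e * k / c`, and `e < 3`.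
    have h4 : Real.log m + 1 + Real.log 2 ≤ Real.log k + l := by
      rw [hl, ← Real.log_mul (by positivity) (by positivity)]
      calc Real.log m + 1 + Real.log 2 = Real.log (m * Real.exp 1 * 2) := by
            rw [Real.log_mul (by positivity) (by positivity),
              Real.log_mul (by positivity) (by positivity), Real.log_exp]
        _ ≤ _ := by
            refine Real.log_le_log (by positivity) ?_
            rw [mul_div_assoc', le_div_iff₀ hc]
            nlinarith
    have h5 : (k : ℝ) * (Real.log m + 1 + Real.log 2) ≤ k * (Real.log k + l) := by gcongr
    have h6 : (k : ℝ) * (2 * l) ≤ k * Real.log s := by gcongr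
    have hlog4 : Real.log 4 ≤ 2 := by
      rw [Real.log_le_iff_le_exp (by norm_num)]
      have h7 : (2 : ℝ) ≤ Real.exp 1 := by linarith [Real.add_one_le_exp (1 : ℝ)]
      have h8 : Real.exp 2 = Real.exp 1 * Real.exp 1 := by rw [← Real.exp_add]; norm_num
      rw [h8]
      nlinarith
    have h7 : (t : ℝ) * Real.log 4 ≤ t * 2 := by gcongr
    have hlog : 0 ≤ Real.log s := Real.log_nonneg (by linarith)
    have h8 : c * m * Real.log s ≤ 2 * k * Real.log s :=
      mul_le_mul_of_nonneg_right (by linarith) hlog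
    have h9 : (k : ℝ) * Real.log s ≤ t * 4 := by linarith
    have h10 : (t : ℝ) * 16 * 1 ≤ t * 16 * l := by gcongr
    linarith [show c * (m * Real.log s) = c * m * Real.log s by ring]

theorem ofReal_le_minOps {m d : ℕ} {B : Matrix (Fin m) (Fin d) ℝ} {y : ℝ}
    (h : ∀ (t : ℕ) (P : LinearAlgorithm d t), P.CoeffBounded 1 → P.Computes B → y ≤ t) :
    ENNReal.ofReal y ≤ (minOps B : ℝ≥0∞) := by
  have h1 : (⌈y⌉₊ : ℕ∞) ≤ minOps B := by
    refine le_iInf₂ fun t ht => ?_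
    obtain ⟨-, P, hP, hc⟩ := ht
    exact_mod_cast Nat.ceil_le.2 (h t P hP hc)
  calc ENNReal.ofReal y ≤ ENNReal.ofReal (⌈y⌉₊ : ℝ) := ENNReal.ofReal_le_ofReal (Nat.le_ceil y)
    _ = (((⌈y⌉₊ : ℕ∞)) : ℝ≥0∞) := by simp
    _ ≤ _ := by exact_mod_cast h1

/-- The expected number of steps, for any admissible window length `n`. -/
theorem IsScaledJL.ofReal_le_expectedMinOps {m d n s : ℕ} {ε δ c : ℝ}
    {μ : Measure (Matrix (Fin m) (Fin d) ℝ)} (hμ : IsScaledJL μ ε δ s) (hε' : ε ≤ 1 / 4)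
    (hc : 0 < c) (hc1 : c ≤ 1) (hm : 0 < m) (hmd : m ≤ d) (hnm : n ≤ m) (hn : c * m ≤ n)
    (hs : 2 ≤ s) (hδn : 64 * δ ≤ Real.exp (-((3000000 * ε) ^ 2 / 2 * n))) :
    ENNReal.ofReal (c / (32 * Real.log (12 / c)) * (m * Real.log s)) ≤ expectedMinOps μ := by
  have hd : NeZero d := ⟨by omega⟩
  have hnd : n ≤ d := hnm.trans hmd
  have hn0 : 0 < n := by
    have : (0 : ℝ) < n := (mul_pos hc (by exact_mod_cast hm)).trans_le hn
    exact_mod_cast this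
  set y := c / (16 * Real.log (12 / c)) * (m * Real.log s) with hy
  set G := {A : Matrix (Fin m) (Fin d) ℝ |
    windowDistortion ε s hnd A < 2 * (d * ENNReal.ofReal δ)} with hG
  have hGm : MeasurableSet G :=
    measurableSet_lt (measurable_windowDistortion ε s hnd) measurable_const
  have hle : ∀ A ∈ G, ENNReal.ofReal y ≤ (minOps A : ℝ≥0∞) := by
    intro A hA
    refine ofReal_le_minOps fun t P hP hPA => ?_
    obtain ⟨h1, k, h2, h3⟩ := hPA.lower_bounds hP hmd hnd hn0 hs
      (card_bad_windows_le hnd hn0 hμ.eps_pos hε' hμ.delta_pos hμ.s_pos hδn hA)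
    exact mul_log_le_of_step_bounds hc hc1 hm hn hs h1 h2 h3
  calc ENNReal.ofReal (c / (32 * Real.log (12 / c)) * (m * Real.log s))
      = ENNReal.ofReal (y * (1 / 2)) := by
        congr 1
        rw [hy, show (32 : ℝ) * Real.log (12 / c) = 16 * Real.log (12 / c) * 2 by ring,
          ← div_div]
        ring
    _ = ENNReal.ofReal y * (1 / 2) := by
        rw [ENNReal.ofReal_mul' (by norm_num)]
        congr 1
        rw [ENNReal.ofReal_div_of_pos (by norm_num)]
        simp
    _ ≤ ENNReal.ofReal y * μ G := by
        gcongr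
        exact hμ.half_le_measure hnd
    _ = ∫⁻ A, G.indicator (fun _ => ENNReal.ofReal y) A ∂μ := by
        rw [lintegral_indicator hGm, setLIntegral_const]
    _ ≤ expectedMinOps μ := by
        refine lintegral_mono fun A => ?_
        by_cases hA : A ∈ G
        · simpa [hA] using hle A hA
        · simp [hA]

theorem theorem1 :
    ∃ C : ℝ, 0 < C ∧ ∀ a b : ℝ, 0 < a → 0 < b → ∃ c : ℝ, 0 < c ∧
      ∀ (m d s : ℕ) (ε δ : ℝ) (μ : Measure (Matrix (Fin m) (Fin d) ℝ)),
        IsScaledJL μ ε δ s → ε ≤ 1 / 4 → δ ≤ C →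
        a * ((ε ^ 2)⁻¹ * Real.log (1 / δ)) ≤ (m : ℝ) →
        (m : ℝ) ≤ b * ((ε ^ 2)⁻¹ * Real.log (1 / δ)) →
        m ≤ d →
        ENNReal.ofReal (c * ((m : ℝ) * Real.log (s : ℝ))) ≤ expectedMinOps μ ∧
        ∀ κ : ℝ, 0 < κ → κ * Real.log (m : ℝ) ≤ Real.log (s : ℝ) →
          ENNReal.ofReal (c * κ * ((m : ℝ) * Real.log (m : ℝ))) ≤ expectedMinOps μ := by
  -- Rounding `c * m` up costs at most `3000000 ^ 2 / 32` in the exponent, as `ε ≤ 1 / 4`, and the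
  -- factor `64 ≤ exp 5` costs `5`. Half of `log (1 / δ)` has to absorb both.
  refine ⟨Real.exp (-(3000000 ^ 2 / 16 + 10)), Real.exp_pos _, fun a b _ hb => ?_⟩
  -- With the upper bound on `m`, this makes `(3000000 * ε) ^ 2 * c * m` at most `log (1 / δ)`.
  set c := min 1 (1 / (3000000 ^ 2 * b)) with hc
  have hc0 : 0 < c := lt_min one_pos (by positivity)
  have hc1 : c ≤ 1 := min_le_left _ _
  have hcb : c * (3000000 ^ 2 * b) ≤ 1 := by
    rw [← le_div_iff₀ (by positivity)]
    exact min_le_right _ _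
  have hlog : 0 < Real.log (12 / c) :=
    Real.log_pos (by rw [lt_div_iff₀ hc0]; linarith)
  refine ⟨c / (32 * Real.log (12 / c)), by positivity, ?_⟩
  intro m d s ε δ μ hμ hε' hδ _ hmb hmd
  have hε := hμ.eps_pos
  have main : ENNReal.ofReal (c / (32 * Real.log (12 / c)) * (m * Real.log s)) ≤
      expectedMinOps μ := by
    rcases Nat.eq_zero_or_pos m with rfl | hm
    · simp
    rcases Nat.lt_or_ge s 2 with hs | hs
    · have : s = 1 := le_antisymm (Nat.lt_succ_iff.1 hs) hμ.s_pos
      simp [this]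
    refine hμ.ofReal_le_expectedMinOps (n := ⌈c * m⌉₊) hε' hc0 hc1 hm hmd ?_ (Nat.le_ceil _) hs ?_
    · exact Nat.ceil_le.2 (mul_le_of_le_one_left (Nat.cast_nonneg m) hc1)
    · set L := Real.log (1 / δ) with hL
      have hδ0 := hμ.delta_pos
      have hδL : δ = Real.exp (-L) := by
        rw [hL, one_div, Real.log_inv, neg_neg, Real.exp_log hδ0]
      have hLge : 3000000 ^ 2 / 16 + 10 ≤ L := by
        rw [hδL, Real.exp_le_exp] at hδ
        linarith
      have hn1 : (⌈c * m⌉₊ : ℝ) ≤ c * m + 1 :=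
        (Nat.ceil_lt_add_one (by positivity)).le
      have hεm : ε ^ 2 * m ≤ b * L := by
        calc ε ^ 2 * m ≤ ε ^ 2 * (b * ((ε ^ 2)⁻¹ * L)) := by gcongr
          _ = b * L := by field_simp
      have hL0 : 0 ≤ L := by linarith
      have h1 : 3000000 ^ 2 * c * (ε ^ 2 * m) ≤ L := by
        calc 3000000 ^ 2 * c * (ε ^ 2 * m) ≤ 3000000 ^ 2 * c * (b * L) := by gcongr
          _ = c * (3000000 ^ 2 * b) * L := by ring
          _ ≤ 1 * L := by gcongr
          _ = L := one_mul L
      have h2 : ε ^ 2 ≤ 1 / 16 := by nlinarith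
      have h3 : (3000000 * ε) ^ 2 / 2 * ⌈c * m⌉₊ ≤ L - 5 := by
        calc _ ≤ (3000000 * ε) ^ 2 / 2 * (c * m + 1) := by gcongr
          _ = 3000000 ^ 2 * c * (ε ^ 2 * m) / 2 + 3000000 ^ 2 / 2 * ε ^ 2 := by ring
          _ ≤ _ := by linarith
      have h4 : (64 : ℝ) ≤ Real.exp 5 := by
        have h5 := Real.exp_one_gt_d9
        have h6 : Real.exp 5 = Real.exp 1 ^ 5 := by rw [← Real.exp_nat_mul]; norm_num
        rw [h6]
        calc (64 : ℝ) ≤ 2.7 ^ 5 := by norm_num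
          _ ≤ _ := by gcongr; linarith
      calc 64 * δ ≤ Real.exp 5 * Real.exp (-L) := by rw [← hδL]; gcongr
        _ = Real.exp (5 - L) := by rw [← Real.exp_add]; congr 1
        _ ≤ _ := Real.exp_le_exp.2 (by linarith)
  refine ⟨main, fun κ _ hκ => le_trans (ENNReal.ofReal_le_ofReal ?_) main⟩
  calc c / (32 * Real.log (12 / c)) * κ * (m * Real.log m)
      = c / (32 * Real.log (12 / c)) * (m * (κ * Real.log m)) := by ring
    _ ≤ _ := by gcongr
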